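/- Let $M$ be a complex vector space of finite dimension $s$, and let $\mathbb{P}\,\mathrm{Sym}^2 M^*$ be the projective space of quadrics in $\mathbb{P}M$, i.e. of nonzero quadratic forms on $M$ up to scalars. The set $$(\mathbb{P}\,\mathrm{Sym}^2 M^*)_{nondeg}\subseteq \mathbb{P}\,\mathrm{Sym}^2 M^*$$ of nondegenerate quadrics is open, both in the Zariski and in the classical topology. Its cohomology with compact supports (classical topology, rational coefficients) has finite total dimension, and its Euler characteristic with compact support $\chi(X)=\sum_{i\ge 0}(-1)^i\dim_{\mathbb{Q}} H^i_c(X;\mathbb{Q})$ is given by $$\chi\big((\mathbb{P}\,\mathrm{Sym}^2 M^*)_{nondeg}\big)=\begin{cases}1, & s=1,2;\\ 0, & s\ge 3.\end{cases}$$ -/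

import Mathlib

open scoped LinearAlgebra.Projectivization Topology

universe u

/-! ### Alexander–Spanier cohomology with compact supports

For a locally compact Hausdorff space this is the usual cohomology with compact supports: it agrees
with the sheaf-theoretic one with coefficients in the constant sheaf. -/

namespace AlexanderSpanier

/-- Rational Alexander–Spanier `n`-cochains on `X`: arbitrary functions `X ^ (n + 1) → ℚ`. -/
abbrev Cochain (X : Type u) (n : ℕ) : Type u := (Fin (n + 1) → X) → ℚ

/-- The coboundary
`(δ φ) (x₀, …, xₙ₊₁) = ∑ᵢ (-1)ⁱ φ (x₀, …, xᵢ₋₁, xᵢ₊₁, …, xₙ₊₁)`. -/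
def delta (X : Type u) (n : ℕ) : Cochain X n →ₗ[ℚ] Cochain X (n + 1) where
  toFun φ x := ∑ i : Fin (n + 2), (-1 : ℚ) ^ (i : ℕ) * φ (i.removeNth x)
  map_add' φ ψ := by
    funext x
    simp [mul_add, Finset.sum_add_distrib]
  map_smul' c φ := by
    funext x
    simp only [Pi.smul_apply, smul_eq_mul, RingHom.id_apply, Finset.mul_sum]
    exact Finset.sum_congr rfl fun i _ => by ring

theorem delta_delta (X : Type u) (n : ℕ) (φ : Cochain X n) :
    delta X (n + 1) (delta X n φ) = 0 := by
  funext x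
  simp only [delta, LinearMap.coe_mk, AddHom.coe_mk, Finset.mul_sum, Pi.zero_apply]
  rw [← Fintype.sum_prod_type'
    (f := fun (i : Fin (n + 3)) (j : Fin (n + 2)) =>
      (-1 : ℚ) ^ (i : ℕ) * ((-1 : ℚ) ^ (j : ℕ) * φ (j.removeNth (i.removeNth x))))]
  refine Finset.sum_involution (fun p _ => (p.1.succAbove p.2, p.2.predAbove p.1)) ?_ ?_ ?_ ?_
  · rintro ⟨i, j⟩ -
    have h := Fin.neg_one_pow_succAbove_add_predAbove (R := ℚ) i j
    simp only
    rw [Fin.removeNth_removeNth_eq_swap x j i, ← mul_assoc, ← mul_assoc, ← pow_add, ← pow_add, h,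
      pow_add]
    ring
  · rintro ⟨i, j⟩ - - h
    exact Fin.succAbove_ne i j (congrArg Prod.fst h)
  · intro p _
    exact Finset.mem_univ _
  · rintro ⟨i, j⟩ -
    exact Prod.ext (Fin.succAbove_succAbove_predAbove i j)
      (Fin.predAbove_predAbove_succAbove i j)

variable {X : Type u} [TopologicalSpace X] {n : ℕ}

/-- The cochain `φ` vanishes on all tuples of points that are sufficiently close to `p`. -/
def ZeroNear (φ : Cochain X n) (p : X) : Prop :=
  ∃ V ∈ 𝓝 p, ∀ x : Fin (n + 1) → X, (∀ i, x i ∈ V) → φ x = 0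

/-- The support of a cochain: the set of points near which it does not vanish. -/
def support (φ : Cochain X n) : Set X := {p | ¬ ZeroNear φ p}

theorem ZeroNear.add {φ ψ : Cochain X n} {p : X} (hφ : ZeroNear φ p) (hψ : ZeroNear ψ p) :
    ZeroNear (φ + ψ) p := by
  obtain ⟨V, hV, h⟩ := hφ
  obtain ⟨W, hW, h'⟩ := hψ
  refine ⟨V ∩ W, Filter.inter_mem hV hW, fun x hx => ?_⟩
  simp [h x fun i => (hx i).1, h' x fun i => (hx i).2]

theorem ZeroNear.smul {φ : Cochain X n} {p : X} (c : ℚ) (hφ : ZeroNear φ p) :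
    ZeroNear (c • φ) p := by
  obtain ⟨V, hV, h⟩ := hφ
  exact ⟨V, hV, fun x hx => by simp [h x hx]⟩

theorem ZeroNear.delta {φ : Cochain X n} {p : X} (hφ : ZeroNear φ p) :
    ZeroNear (delta X n φ) p := by
  obtain ⟨V, hV, h⟩ := hφ
  refine ⟨V, hV, fun x hx => ?_⟩
  simp only [AlexanderSpanier.delta, LinearMap.coe_mk, AddHom.coe_mk]
  exact Finset.sum_eq_zero fun i _ => by
    rw [h (i.removeNth x) fun j => hx _, mul_zero]

theorem isClosed_support (φ : Cochain X n) : IsClosed (support φ) := by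
  rw [← isOpen_compl_iff, isOpen_iff_mem_nhds]
  intro p hp
  obtain ⟨V, hV, h⟩ := not_not.1 hp
  filter_upwards [eventually_mem_nhds_iff.2 hV] with q hq using not_not.2 ⟨V, hq, h⟩

variable (X n)

/-- Cochains with empty support. -/
def locallyZero : Submodule ℚ (Cochain X n) where
  carrier := {φ | ∀ p, ZeroNear φ p}
  zero_mem' _ := ⟨Set.univ, Filter.univ_mem, fun _ _ => rfl⟩
  add_mem' hφ hψ p := (hφ p).add (hψ p)
  smul_mem' c _ hφ p := (hφ p).smul c

/-- Cochains with compact support. -/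
def compactlySupported : Submodule ℚ (Cochain X n) where
  carrier := {φ | IsCompact (support φ)}
  zero_mem' := by
    have h : support (0 : Cochain X n) = ∅ :=
      Set.eq_empty_of_forall_notMem fun p hp => hp ⟨Set.univ, Filter.univ_mem, fun _ _ => rfl⟩
    simp [h]
  add_mem' {φ ψ} hφ hψ := by
    refine (hφ.union hψ).of_isClosed_subset (isClosed_support _) fun p hp => ?_
    by_contra h
    rw [Set.mem_union, not_or] at h
    exact hp ((not_not.1 h.1).add (not_not.1 h.2))
  smul_mem' c φ hφ :=
    hφ.of_isClosed_subset (isClosed_support _) fun _ hp h => hp (h.smul c)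

/-- Compactly supported Alexander–Spanier cochains: cochains with compact support modulo cochains
with empty support. -/
abbrev CompactCochain : Type u :=
  compactlySupported X n ⧸ (locallyZero X n).submoduleOf (compactlySupported X n)

theorem delta_mem_compactlySupported (φ : Cochain X n) (hφ : φ ∈ compactlySupported X n) :
    delta X n φ ∈ compactlySupported X (n + 1) :=
  IsCompact.of_isClosed_subset hφ (isClosed_support _) fun _ hp h => hp h.delta

/-- The coboundary induced on compactly supported Alexander–Spanier cochains. -/
def compactDelta : CompactCochain X n →ₗ[ℚ] CompactCochain X (n + 1) :=
  Submodule.mapQ _ _ ((delta X n).restrict (delta_mem_compactlySupported X n))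
    fun _ hφ p => (hφ p).delta

open CategoryTheory in
/-- The complex of compactly supported rational Alexander–Spanier cochains of `X`. -/
noncomputable def compactComplex : CochainComplex (ModuleCat.{u} ℚ) ℕ :=
  CochainComplex.of (fun n => ModuleCat.of ℚ (CompactCochain X n))
    (fun n => ModuleCat.ofHom (compactDelta X n)) fun n => by
      refine ModuleCat.hom_ext (LinearMap.ext fun φ => ?_)
      obtain ⟨φ, rfl⟩ := Submodule.Quotient.mk_surjective _ φ
      have h : ((delta X (n + 1)).restrict (delta_mem_compactlySupported X (n + 1)))
          ((delta X n).restrict (delta_mem_compactlySupported X n) φ) = 0 :=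
        Subtype.ext (delta_delta X n φ)
      exact congrArg (Submodule.Quotient.mk
        (p := (locallyZero X (n + 2)).submoduleOf (compactlySupported X (n + 2)))) h

end AlexanderSpanier

/-- The cohomology with compact supports `H_c^n(X; ℚ)`. -/
noncomputable abbrev compactCohomology (X : Type u) [TopologicalSpace X] (n : ℕ) :
    ModuleCat.{u} ℚ :=
  (AlexanderSpanier.compactComplex X).homology n

/-- The Euler characteristic with compact support `∑ₙ (-1)ⁿ dim H_c^n(X; ℚ)`. -/
noncomputable def compactEulerChar (X : Type u) [TopologicalSpace X] : ℤ :=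
  (AlexanderSpanier.compactComplex X).homologyEulerChar

/-- The space `X` has finite-dimensional total rational cohomology with compact supports, so that
`compactEulerChar X` is a genuine finite alternating sum of dimensions. -/
def HasFiniteCompactCohomology (X : Type u) [TopologicalSpace X] : Prop :=
  (∀ n, Module.Finite ℚ (compactCohomology X n)) ∧
    {n | ¬ Subsingleton (compactCohomology X n)}.Finite

/-! ### Topologies on projective space, and nondegenerate quadrics -/

/-- The classical topology on the complex projective space `ℙ ℂ V`: the quotient topology from
`V ∖ {0}`, where `V` has its module topology (for `V` finite-dimensional, the topology
of `ℂ ^ d` in any system of linear coordinates). -/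
noncomputable instance complexProjectiveTopology (V : Type*) [AddCommGroup V] [Module ℂ V] :
    TopologicalSpace (ℙ ℂ V) :=
  letI : TopologicalSpace V := moduleTopology ℂ V
  TopologicalSpace.coinduced (Projectivization.mk' ℂ)
    (inferInstance : TopologicalSpace {v : V // v ≠ 0})

/-- Zariski open subsets of `ℙ ℂ V`: complements of common zero loci of homogeneous polynomials in
the linear forms on `V`. -/
def IsZariskiOpen {V : Type*} [AddCommGroup V] [Module ℂ V] (U : Set (ℙ ℂ V)) : Prop :=
  ∃ S : Set (MvPolynomial (Module.Dual ℂ V) ℂ),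
    (∀ P ∈ S, ∃ d : ℕ, P.IsHomogeneous d) ∧
      U = {p | ∃ P ∈ S, MvPolynomial.eval (fun f : Module.Dual ℂ V => f p.rep) P ≠ 0}

/-- The set of nondegenerate quadrics in the space `ℙ (Sym² M*)` of quadrics in `ℙ M`; here
`Sym² M*` is the space of quadratic forms on `M`, and the condition does not depend on the chosen
representative of the quadric. -/
def nondegenerateQuadrics (M : Type*) [AddCommGroup M] [Module ℂ M] :
    Set (ℙ ℂ (QuadraticForm ℂ M)) :=
  {q | q.rep.Nondegenerate}

/-!
The Euler characteristic with compact supports is additive: if `Z` is closed in a locally compact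
Hausdorff space `X`, then `χ(X) = χ(Z) + χ(X ∖ Z)` (`HasChi.of_closed_of_compl`, `HasChi.compl`). This
comes from the long exact sequence of the cochains on `X` restricting to zero on `Z`, which compute
the cohomology of the complement because closed subsets are taut: a neighbourhood of a compact part
of `Z` retracts onto `Z` by a possibly discontinuous map moving points arbitrarily little
(`exists_small_retraction`), and the prism operator (`augDelta_prism`) shows that such a map does not
change cohomology classes. The same operator gives a form of homotopy invariance
(`mem_boundaries_of_homotopy`), whence `χ(X × [0, ∞)) = 0`. By additivity `χ(X × ℂ) = χ(X)` and
`χ(X × ℂˣ) = 0`.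

In a basis of `M` a quadric is a symmetric matrix up to scaling. The nondegenerate quadrics are
stratified by the position `k` of the first nonzero entry in the first row of the matrix, which can
be scaled to `1`. Clearing the rest of the first row by a unipotent change of basis splits off an
affine space (`pivotHomeomorph`), and leaves the matrices whose first row is the `k`-th basis vector.
For `k = 0` these split as `1 ⊕ C`, and for `k > 0` they contain a hyperbolic plane
(`unitRowZeroHomeomorph`, `unitRowSuccHomeomorph`). So, for matrices of size `s = n + 1`, the
stratum `k` has the Euler characteristic of the space of nondegenerate symmetric matrices of size `n`
if `k = 0`, and of size `n - 1` if `k > 0`. That space carries a similar stratification with strata of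
the form `Y × ℂˣ`, so its Euler characteristic vanishes, except in size zero where it is a point
(`hasChi_nondeg`). Hence only the stratum `k = 0` for `s = 1` and the stratum `k = 1` for `s = 2`
contribute, with one each.
-/

universe v

/-! ### Cohomology of a sequence of linear maps -/

namespace SeqCohomology

section Basic

variable {A B C : ℕ → Type*} [∀ n, AddCommGroup (A n)] [∀ n, Module ℚ (A n)]
  [∀ n, AddCommGroup (B n)] [∀ n, Module ℚ (B n)] [∀ n, AddCommGroup (C n)] [∀ n, Module ℚ (C n)]

/-- The coboundaries in degree `n`; in degree `0` there are none. -/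
def coboundaries (d : ∀ n, A n →ₗ[ℚ] A (n + 1)) : ∀ n, Submodule ℚ (A n)
  | 0 => ⊥
  | n + 1 => LinearMap.range (d n)

/-- The cohomology of a sequence of linear maps, cocycles modulo coboundaries. -/
def Cohomology (d : ∀ n, A n →ₗ[ℚ] A (n + 1)) (n : ℕ) :=
  LinearMap.ker (d n) ⧸ (coboundaries d n).submoduleOf (LinearMap.ker (d n))

noncomputable instance instAddCommGroupCohomology (d : ∀ n, A n →ₗ[ℚ] A (n + 1)) (n : ℕ) :
    AddCommGroup (Cohomology d n) :=
  Submodule.Quotient.addCommGroup _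

noncomputable instance instModuleCohomology (d : ∀ n, A n →ₗ[ℚ] A (n + 1)) (n : ℕ) :
    Module ℚ (Cohomology d n) :=
  Submodule.Quotient.module _

variable {dA : ∀ n, A n →ₗ[ℚ] A (n + 1)} {dB : ∀ n, B n →ₗ[ℚ] B (n + 1)}
  {dC : ∀ n, C n →ₗ[ℚ] C (n + 1)}

/-- The cohomology class of a cocycle. -/
def mk (a : A n) (ha : dA n a = 0) : Cohomology dA n := Submodule.Quotient.mk ⟨a, ha⟩

theorem mk_surjective {n : ℕ} (x : Cohomology dA n) : ∃ a, ∃ ha : dA n a = 0, mk a ha = x := by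
  obtain ⟨⟨a, ha⟩, rfl⟩ := Submodule.Quotient.mk_surjective _ x
  exact ⟨a, ha, rfl⟩

theorem mk_eq_mk {n : ℕ} {a b : A n} (ha : dA n a = 0) (hb : dA n b = 0) :
    mk a ha = mk b hb ↔ a - b ∈ coboundaries dA n :=
  (Submodule.Quotient.eq _).trans Iff.rfl

theorem mk_eq_zero {n : ℕ} {a : A n} (ha : dA n a = 0) :
    mk a ha = 0 ↔ a ∈ coboundaries dA n :=
  (Submodule.Quotient.mk_eq_zero _).trans Iff.rfl

theorem map_mem_coboundaries {f : ∀ n, A n →ₗ[ℚ] B n}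
    (hf : ∀ n a, f (n + 1) (dA n a) = dB n (f n a)) {n : ℕ} {a : A n}
    (ha : a ∈ coboundaries dA n) : f n a ∈ coboundaries dB n := by
  cases n with
  | zero =>
    obtain rfl : a = 0 := ha
    rw [map_zero]; exact zero_mem _
  | succ n =>
    obtain ⟨b, rfl⟩ := ha
    exact ⟨f n b, (hf n b).symm⟩

/-- The map induced on cohomology by a cochain map. -/
def map (f : ∀ n, A n →ₗ[ℚ] B n) (hf : ∀ n a, f (n + 1) (dA n a) = dB n (f n a)) (n : ℕ) :
    Cohomology dA n →ₗ[ℚ] Cohomology dB n :=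
  Submodule.mapQ _ _ ((f n).restrict (p := LinearMap.ker (dA n)) (q := LinearMap.ker (dB n))
    fun a ha => by rw [LinearMap.mem_ker] at *; rw [← hf, ha, map_zero])
    fun _ ha => map_mem_coboundaries hf ha

theorem map_mk {f : ∀ n, A n →ₗ[ℚ] B n} (hf : ∀ n a, f (n + 1) (dA n a) = dB n (f n a)) {n : ℕ}
    {a : A n} (ha : dA n a = 0) :
    map f hf n (mk a ha) = mk (f n a) (by rw [← hf, ha, map_zero]) := rfl

/-- Isomorphic sequences have isomorphic cohomology. -/
noncomputable def cohomologyEquiv (e : ∀ n, A n ≃ₗ[ℚ] B n)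
    (he : ∀ n a, e (n + 1) (dA n a) = dB n (e n a)) (n : ℕ) :
    Cohomology dA n ≃ₗ[ℚ] Cohomology dB n :=
  LinearEquiv.ofBijective (map (fun n => (e n : A n →ₗ[ℚ] B n)) he n) <| by
    have he' : ∀ n b, (e (n + 1)).symm (dB n b) = dA n ((e n).symm b) := fun n b => by
      rw [LinearEquiv.symm_apply_eq, he, LinearEquiv.apply_symm_apply]
    constructor
    · rw [injective_iff_map_eq_zero]
      intro x hx
      obtain ⟨a, ha, rfl⟩ := mk_surjective x
      rw [map_mk, mk_eq_zero] at hx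
      rw [mk_eq_zero]
      simpa using map_mem_coboundaries (f := fun n => ((e n).symm : B n →ₗ[ℚ] A n)) he' hx
    · intro y
      obtain ⟨b, hb, rfl⟩ := mk_surjective y
      refine ⟨mk ((e n).symm b) (by rw [← he', hb, map_zero]), ?_⟩
      rw [map_mk]
      congr 1
      exact (e n).apply_symm_apply b

/-- A bijective cochain map induces an isomorphism on cohomology. -/
noncomputable def cohomologyEquivOfBijective (f : ∀ n, A n →ₗ[ℚ] B n)
    (hf : ∀ n a, f (n + 1) (dA n a) = dB n (f n a)) (h : ∀ n, Function.Bijective (f n)) (n : ℕ) :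
    Cohomology dA n ≃ₗ[ℚ] Cohomology dB n :=
  cohomologyEquiv (fun n => LinearEquiv.ofBijective (f n) (h n)) hf n

/-- The long exact cohomology sequence of a short exact sequence of cochain complexes of vector
spaces. -/
theorem exists_connecting (hdB : ∀ n b, dB (n + 1) (dB n b) = 0)
    (f : ∀ n, A n →ₗ[ℚ] B n) (hf : ∀ n a, f (n + 1) (dA n a) = dB n (f n a))
    (g : ∀ n, B n →ₗ[ℚ] C n) (hg : ∀ n b, g (n + 1) (dB n b) = dC n (g n b))
    (hinj : ∀ n, Function.Injective (f n)) (hex : ∀ n, Function.Exact (f n) (g n))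
    (hsurj : ∀ n, Function.Surjective (g n)) :
    ∃ δ : ∀ n, Cohomology dC n →ₗ[ℚ] Cohomology dA (n + 1),
      (∀ n, Function.Exact (map f hf n) (map g hg n)) ∧
      (∀ n, Function.Exact (map g hg n) (δ n)) ∧
      (∀ n, Function.Exact (δ n) (map f hf (n + 1))) ∧ Function.Injective (map f hf 0) := by
  have hs : ∀ n, ∃ s : C n →ₗ[ℚ] B n, g n ∘ₗ s = LinearMap.id := fun n =>
    LinearMap.exists_rightInverse_of_surjective _ (LinearMap.range_eq_top.2 (hsurj n))
  have hr : ∀ n, ∃ r : B n →ₗ[ℚ] A n, r ∘ₗ f n = LinearMap.id := fun n =>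
    LinearMap.exists_leftInverse_of_injective _ (LinearMap.ker_eq_bot.2 (hinj n))
  choose s hs using hs
  choose r hr using hr
  have hs' : ∀ n c, g n (s n c) = c := fun n c => LinearMap.congr_fun (hs n) c
  have hr' : ∀ n a, r n (f n a) = a := fun n a => LinearMap.congr_fun (hr n) a
  have hfr : ∀ n b, g n b = 0 → f n (r n b) = b := fun n b hb => by
    obtain ⟨a, rfl⟩ := (hex n b).1 hb
    rw [hr']
  have hgf : ∀ n a, g n (f n a) = 0 := fun n a => (hex n _).2 ⟨a, rfl⟩
  have hcyc : ∀ n (b : B n), dC n (g n b) = 0 → dA (n + 1) (r (n + 1) (dB n b)) = 0 :=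
    fun n b hb => by
      apply hinj
      rw [hf, hfr _ _ (by rw [hg, hb]), hdB, map_zero]
  -- the image of a coboundary under the snake map is a coboundary
  have hbd : ∀ n (b : B n), g n b ∈ coboundaries dC n →
      r (n + 1) (dB n b) ∈ LinearMap.range (dA n) := by
    intro n b hb
    have key : ∀ b' : B n, dB n b' = 0 → g n (b - b') = 0 →
        r (n + 1) (dB n b) ∈ LinearMap.range (dA n) := fun b' hb' hbb => by
      refine ⟨r n (b - b'), ?_⟩
      apply hinj
      rw [hf, hfr _ _ hbb, hfr, map_sub, hb', sub_zero]
      rw [hg, show g n b = g n b' by rw [← sub_eq_zero, ← map_sub, hbb], ← hg, hb', map_zero]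
    cases n with
    | zero =>
      refine key 0 (map_zero _) ?_
      rw [sub_zero]; exact hb
    | succ n =>
      obtain ⟨c, hc⟩ := hb
      refine key (dB n (s n c)) (hdB _ _) ?_
      rw [map_sub, hg, hs', hc, sub_self]
  let δ : ∀ n, Cohomology dC n →ₗ[ℚ] Cohomology dA (n + 1) := fun n =>
    Submodule.mapQ _ _ ((r (n + 1) ∘ₗ dB n ∘ₗ s n).restrict (p := LinearMap.ker (dC n))
      (q := LinearMap.ker (dA (n + 1))) fun c hc => by
        have hc' := LinearMap.mem_ker.1 hc
        exact hcyc n (s n c) (by rwa [hs']))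
      fun c hc => hbd n (s n c) (by rw [hs']; exact hc)
  have hδ : ∀ n (b : B n) (hb : dC n (g n b) = 0),
      δ n (mk (g n b) hb) = mk (r (n + 1) (dB n b)) (hcyc n b hb) := fun n b hb => by
    have hb' : dC n (g n (s n (g n b))) = 0 := by rw [hs', hb]
    refine (mk_eq_mk (hcyc n _ hb') (hcyc n b hb)).2 ?_
    rw [← map_sub, ← map_sub]
    refine hbd n _ ?_
    rw [map_sub, hs', sub_self]; exact zero_mem _
  refine ⟨δ, fun n y => ⟨fun hy => ?_, ?_⟩, fun n z => ⟨fun hz => ?_, ?_⟩,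
    fun n x => ⟨fun hx => ?_, ?_⟩, ?_⟩
  · obtain ⟨b, hb, rfl⟩ := mk_surjective y
    rw [map_mk, mk_eq_zero] at hy
    have key : ∀ b' : B n, dB n b' = 0 → b' ∈ coboundaries dB n → g n (b - b') = 0 →
        mk b hb ∈ Set.range (map f hf n) := fun b' hb' hb'' hbb => by
      have h0 : dA n (r n (b - b')) = 0 := by
        apply hinj
        rw [hf, hfr _ _ hbb, map_sub, hb, hb', sub_zero, map_zero]
      refine ⟨mk (r n (b - b')) h0, ?_⟩
      rw [map_mk, mk_eq_mk, hfr _ _ hbb, sub_sub_cancel_left]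
      exact neg_mem hb''
    cases n with
    | zero =>
      refine key 0 (map_zero _) (zero_mem _) ?_
      rw [sub_zero]; exact hy
    | succ n =>
      obtain ⟨c, hc⟩ := hy
      refine key (dB n (s n c)) (hdB _ _) ⟨_, rfl⟩ ?_
      rw [map_sub, hg, hs', hc, sub_self]
  · rintro ⟨x, rfl⟩
    obtain ⟨a, ha, rfl⟩ := mk_surjective x
    rw [map_mk, map_mk, mk_eq_zero, hgf]
    exact zero_mem _
  · obtain ⟨c, hc, rfl⟩ := mk_surjective z
    obtain ⟨b, rfl⟩ := hsurj n c
    rw [hδ, mk_eq_zero] at hz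
    obtain ⟨a, ha⟩ := hz
    have h0 : dB n (b - f n a) = 0 := by
      rw [map_sub, ← hf, ha, hfr, sub_self]
      rw [hg, hc]
    refine ⟨mk (b - f n a) h0, ?_⟩
    rw [map_mk, mk_eq_mk, map_sub, hgf, sub_zero, sub_self]
    exact zero_mem _
  · rintro ⟨y, rfl⟩
    obtain ⟨b, hb, rfl⟩ := mk_surjective y
    rw [map_mk, hδ, mk_eq_zero, hb, map_zero]
    exact zero_mem _
  · obtain ⟨a, ha, rfl⟩ := mk_surjective x
    rw [map_mk, mk_eq_zero] at hx
    obtain ⟨b, hb⟩ := hx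
    have h0 : dC n (g n b) = 0 := by rw [← hg, hb, hgf]
    refine ⟨mk (g n b) h0, ?_⟩
    rw [hδ, mk_eq_mk, hb, hr', sub_self]
    exact zero_mem _
  · rintro ⟨z, rfl⟩
    obtain ⟨c, hc, rfl⟩ := mk_surjective z
    obtain ⟨b, rfl⟩ := hsurj n c
    rw [hδ, map_mk, mk_eq_zero, hfr]
    · exact ⟨b, rfl⟩
    · rw [hg, hc]
  · rw [injective_iff_map_eq_zero]
    intro x hx
    obtain ⟨a, ha, rfl⟩ := mk_surjective x
    rw [map_mk, mk_eq_zero] at hx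
    rw [mk_eq_zero]
    refine hinj 0 ?_
    rw [map_zero]; exact hx

end Basic

/-! ### Euler characteristics of graded vector spaces -/

section Euler

variable {A B C : ℕ → Type*} [∀ n, AddCommGroup (A n)] [∀ n, Module ℚ (A n)]
  [∀ n, AddCommGroup (B n)] [∀ n, Module ℚ (B n)] [∀ n, AddCommGroup (C n)] [∀ n, Module ℚ (C n)]

/-- The graded vector space `A` has finite total dimension and Euler characteristic `c`. -/
def HasEuler (A : ℕ → Type*) [∀ n, AddCommGroup (A n)] [∀ n, Module ℚ (A n)] (c : ℤ) : Prop :=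
  (∀ n, Module.Finite ℚ (A n)) ∧ ∃ N, (∀ n, N ≤ n → Subsingleton (A n)) ∧
    ∑ n ∈ Finset.range N, (-1) ^ n * (Module.finrank ℚ (A n) : ℤ) = c

theorem sum_range_finrank_eq {N N' : ℕ} (h : ∀ n, N ≤ n → Subsingleton (A n)) (hN : N ≤ N') :
    ∑ n ∈ Finset.range N', (-1) ^ n * (Module.finrank ℚ (A n) : ℤ) =
      ∑ n ∈ Finset.range N, (-1) ^ n * (Module.finrank ℚ (A n) : ℤ) := by
  refine (Finset.sum_subset (Finset.range_mono hN) fun n _ hn => ?_).symm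
  have := h n (by simpa using hn)
  rw [Module.finrank_zero_of_subsingleton]; simp

theorem HasEuler.congr {c : ℤ} (h : HasEuler A c) (e : ∀ n, A n ≃ₗ[ℚ] B n) : HasEuler B c := by
  obtain ⟨hf, N, hN, hc⟩ := h
  refine ⟨fun n => Module.Finite.equiv (e n), N, fun n hn => ?_, ?_⟩
  · have := hN n hn
    exact (e n).symm.toEquiv.subsingleton
  · rw [← hc]
    exact Finset.sum_congr rfl fun n _ => by rw [(e n).finrank_eq]

theorem HasEuler.exists_bound {c : ℤ} (h : HasEuler A c) : ∃ N, ∀ N', N ≤ N' →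
    (∀ n, N' ≤ n → Subsingleton (A n)) ∧
    ∑ n ∈ Finset.range N', (-1) ^ n * (Module.finrank ℚ (A n) : ℤ) = c := by
  obtain ⟨hf, N, hN, hc⟩ := h
  exact ⟨N, fun N' hN' => ⟨fun n hn => hN n (hN'.trans hn), by
    rw [sum_range_finrank_eq hN hN', hc]⟩⟩

theorem hasEuler_zero (h : ∀ n, Subsingleton (A n)) : HasEuler A 0 :=
  ⟨fun _ => inferInstance, 0, fun n _ => h n, rfl⟩

variable {f : ∀ n, A n →ₗ[ℚ] B n} {g : ∀ n, B n →ₗ[ℚ] C n} {δ : ∀ n, C n →ₗ[ℚ] A (n + 1)}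

theorem finite_middle {U V W : Type*} [AddCommGroup U] [Module ℚ U] [AddCommGroup V] [Module ℚ V]
    [AddCommGroup W] [Module ℚ W] {f : U →ₗ[ℚ] V} {g : V →ₗ[ℚ] W} (h : Function.Exact f g)
    [Module.Finite ℚ U] [Module.Finite ℚ W] : Module.Finite ℚ V := by
  have h1 : Module.Finite ℚ (LinearMap.ker g) := by
    rw [LinearMap.exact_iff.1 h]
    infer_instance
  have h2 : Module.Finite ℚ (V ⧸ LinearMap.ker g) :=
    Module.Finite.equiv g.quotKerEquivRange.symm
  exact Module.Finite.of_submodule_quotient (LinearMap.ker g)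

theorem finrank_middle {U V W : Type*} [AddCommGroup U] [Module ℚ U] [AddCommGroup V] [Module ℚ V]
    [AddCommGroup W] [Module ℚ W] {f : U →ₗ[ℚ] V} {g : V →ₗ[ℚ] W} (h : Function.Exact f g)
    [Module.Finite ℚ V] : Module.finrank ℚ V =
      Module.finrank ℚ (LinearMap.range f) + Module.finrank ℚ (LinearMap.range g) := by
  rw [← LinearMap.exact_iff.1 h, add_comm, LinearMap.finrank_range_add_finrank_ker]

theorem subsingleton_middle {U V W : Type*} [AddCommGroup U] [Module ℚ U] [AddCommGroup V]
    [Module ℚ V] [AddCommGroup W] [Module ℚ W] {f : U →ₗ[ℚ] V} {g : V →ₗ[ℚ] W}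
    (h : Function.Exact f g) [Subsingleton U] [Subsingleton W] : Subsingleton V := by
  refine subsingleton_of_forall_eq 0 fun v => ?_
  obtain ⟨u, rfl⟩ := (h v).1 (Subsingleton.elim _ _)
  rw [Subsingleton.elim u 0, map_zero]

theorem finrank_range_of_subsingleton {U V : Type*} [AddCommGroup U] [Module ℚ U] [AddCommGroup V]
    [Module ℚ V] [Subsingleton U] (f : U →ₗ[ℚ] V) : Module.finrank ℚ (LinearMap.range f) = 0 := by
  rw [show f = 0 from LinearMap.ext fun u => by rw [Subsingleton.elim u 0, map_zero, map_zero],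
    LinearMap.range_zero, finrank_bot]

/-- Truncating a long exact sequence after degree `N` leaves only the rank of the last connecting
map. -/
theorem alternating_sum_eq (h₁ : ∀ n, Function.Exact (f n) (g n))
    (h₂ : ∀ n, Function.Exact (g n) (δ n)) (h₃ : ∀ n, Function.Exact (δ n) (f (n + 1)))
    (h₀ : Function.Injective (f 0)) [∀ n, Module.Finite ℚ (A n)] [∀ n, Module.Finite ℚ (B n)]
    [∀ n, Module.Finite ℚ (C n)] (N : ℕ) :
    ∑ n ∈ Finset.range (N + 1), (-1) ^ n * (Module.finrank ℚ (A n) : ℤ) +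
      ∑ n ∈ Finset.range (N + 1), (-1) ^ n * (Module.finrank ℚ (C n) : ℤ) =
      ∑ n ∈ Finset.range (N + 1), (-1) ^ n * (Module.finrank ℚ (B n) : ℤ) +
        (-1) ^ N * (Module.finrank ℚ (LinearMap.range (δ N)) : ℤ) := by
  induction N with
  | zero =>
    have hA := LinearMap.finrank_range_of_inj h₀
    have hB := finrank_middle (h₁ 0)
    have hC := finrank_middle (h₂ 0)
    simp
    lia
  | succ N ih =>
    have hA := finrank_middle (h₃ N)
    have hB := finrank_middle (h₁ (N + 1))
    have hC := finrank_middle (h₂ (N + 1))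
    rw [Finset.sum_range_succ, Finset.sum_range_succ (n := N + 1),
      Finset.sum_range_succ (n := N + 1), hA, hB, hC]
    push_cast
    rw [pow_succ]
    linear_combination ih

/-- In a long exact sequence the Euler characteristic of the middle term is the sum of the other
two. -/
theorem HasEuler.middle (h₁ : ∀ n, Function.Exact (f n) (g n))
    (h₂ : ∀ n, Function.Exact (g n) (δ n)) (h₃ : ∀ n, Function.Exact (δ n) (f (n + 1)))
    (h₀ : Function.Injective (f 0)) {a c : ℤ} (hA : HasEuler A a) (hC : HasEuler C c) :
    HasEuler B (a + c) := by
  have hA' := hA.1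
  have hC' := hC.1
  have hB' : ∀ n, Module.Finite ℚ (B n) := fun n => finite_middle (h₁ n)
  obtain ⟨N₁, hN₁⟩ := hA.exists_bound
  obtain ⟨N₂, hN₂⟩ := hC.exists_bound
  set N := max N₁ N₂ with hN
  obtain ⟨hA1, hA2⟩ := hN₁ (N + 1) (by lia)
  obtain ⟨hC1, hC2⟩ := hN₂ (N + 1) (by lia)
  have := (hN₂ N (by lia)).1 N le_rfl
  refine ⟨hB', N + 1, fun n hn => ?_, ?_⟩
  · have := hA1 n hn
    have := hC1 n hn
    exact subsingleton_middle (h₁ n)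
  · have key := alternating_sum_eq h₁ h₂ h₃ h₀ N
    rw [hA2, hC2, finrank_range_of_subsingleton] at key
    simpa using key.symm

/-- In a long exact sequence the Euler characteristic of the first term is determined by those of
the other two. -/
theorem HasEuler.left (h₁ : ∀ n, Function.Exact (f n) (g n))
    (h₂ : ∀ n, Function.Exact (g n) (δ n)) (h₃ : ∀ n, Function.Exact (δ n) (f (n + 1)))
    (h₀ : Function.Injective (f 0)) {b c : ℤ} (hB : HasEuler B b) (hC : HasEuler C c) :
    HasEuler A (b - c) := by
  have hB' := hB.1
  have hC' := hC.1
  have hA' : ∀ n, Module.Finite ℚ (A n) := fun n => by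
    cases n with
    | zero => exact Module.Finite.of_injective _ h₀
    | succ n => exact finite_middle (h₃ n)
  obtain ⟨N₁, hN₁⟩ := hB.exists_bound
  obtain ⟨N₂, hN₂⟩ := hC.exists_bound
  set N := max N₁ N₂ with hN
  obtain ⟨hB1, hB2⟩ := hN₁ (N + 1) (by lia)
  obtain ⟨hC1, hC2⟩ := hN₂ (N + 1) (by lia)
  have := (hN₂ N (by lia)).1 N le_rfl
  refine ⟨hA', N + 1, fun n hn => ?_, ?_⟩
  · obtain ⟨m, rfl⟩ : ∃ m, n = m + 1 := ⟨n - 1, by lia⟩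
    have := (hN₁ N (by lia)).1 (m + 1) (by lia)
    have := (hN₂ N (by lia)).1 m (by lia)
    exact subsingleton_middle (h₃ m)
  · have key := alternating_sum_eq h₁ h₂ h₃ h₀ N
    rw [hB2, hC2, finrank_range_of_subsingleton] at key
    simp only [Nat.cast_zero, mul_zero, add_zero] at key
    linarith

end Euler

end SeqCohomology

namespace AlexanderSpanier

open SeqCohomology

/-! ### Cochains modulo cochains with empty support -/

section Quotient

variable {X : Type u} [TopologicalSpace X]

/-- The cochains in `S` modulo cochains with empty support. -/
def QuotCochain {n : ℕ} (S : Submodule ℚ (Cochain X n)) : Type u :=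
  S ⧸ (locallyZero X n).submoduleOf S

noncomputable instance {n : ℕ} (S : Submodule ℚ (Cochain X n)) : AddCommGroup (QuotCochain S) :=
  Submodule.Quotient.addCommGroup _

noncomputable instance {n : ℕ} (S : Submodule ℚ (Cochain X n)) : Module ℚ (QuotCochain S) :=
  Submodule.Quotient.module _

/-- The class of a cochain. -/
def cls {n : ℕ} {S : Submodule ℚ (Cochain X n)} (φ : Cochain X n) (hφ : φ ∈ S) : QuotCochain S :=
  Submodule.Quotient.mk ⟨φ, hφ⟩

theorem cls_surjective {n : ℕ} {S : Submodule ℚ (Cochain X n)} (x : QuotCochain S) :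
    ∃ φ, ∃ hφ : φ ∈ S, cls φ hφ = x := by
  obtain ⟨⟨φ, hφ⟩, rfl⟩ := Submodule.Quotient.mk_surjective _ x
  exact ⟨φ, hφ, rfl⟩

theorem cls_eq {n : ℕ} {S : Submodule ℚ (Cochain X n)} {φ ψ : Cochain X n} (hφ : φ ∈ S)
    (hψ : ψ ∈ S) : cls φ hφ = cls ψ hψ ↔ φ - ψ ∈ locallyZero X n :=
  (Submodule.Quotient.eq _).trans Iff.rfl

theorem cls_eq_zero {n : ℕ} {S : Submodule ℚ (Cochain X n)} {φ : Cochain X n} (hφ : φ ∈ S) :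
    cls φ hφ = 0 ↔ φ ∈ locallyZero X n :=
  (Submodule.Quotient.mk_eq_zero _).trans Iff.rfl

/-- A linear map of cochains preserving cochains with empty support induces a map of quotients. -/
def quotMap {Y : Type v} [TopologicalSpace Y] {n m : ℕ} {S : Submodule ℚ (Cochain X n)}
    {S' : Submodule ℚ (Cochain Y m)} (T : Cochain X n →ₗ[ℚ] Cochain Y m)
    (hc : ∀ φ ∈ S, T φ ∈ S') (hz : ∀ φ ∈ locallyZero X n, T φ ∈ locallyZero Y m) :
    QuotCochain S →ₗ[ℚ] QuotCochain S' :=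
  Submodule.mapQ _ _ (T.restrict hc) fun φ hφ => hz φ hφ

theorem quotMap_cls {Y : Type v} [TopologicalSpace Y] {n m : ℕ} {S : Submodule ℚ (Cochain X n)}
    {S' : Submodule ℚ (Cochain Y m)} {T : Cochain X n →ₗ[ℚ] Cochain Y m}
    (hc : ∀ φ ∈ S, T φ ∈ S') (hz : ∀ φ ∈ locallyZero X n, T φ ∈ locallyZero Y m)
    {φ : Cochain X n} (hφ : φ ∈ S) : quotMap hc hz (T := T) (cls φ hφ) = cls (T φ) (hc φ hφ) := rfl

theorem delta_mem_locallyZero {n : ℕ} (φ : Cochain X n) (hφ : φ ∈ locallyZero X n) :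
    delta X n φ ∈ locallyZero X (n + 1) := fun p => (hφ p).delta

variable (X) in
/-- Compactly supported cochains modulo cochains with empty support. -/
abbrev Compact (n : ℕ) : Type u := QuotCochain (compactlySupported X n)

variable (X) in
/-- The coboundary on compactly supported cochains. -/
def compactD (n : ℕ) : Compact X n →ₗ[ℚ] Compact X (n + 1) :=
  quotMap (delta X n) (delta_mem_compactlySupported X n) delta_mem_locallyZero

theorem compactD_cls {n : ℕ} {φ : Cochain X n} (hφ : φ ∈ compactlySupported X n) :
    compactD X n (cls φ hφ) = cls (delta X n φ) (delta_mem_compactlySupported X n φ hφ) := rfl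

theorem compactD_compactD {n : ℕ} (x : Compact X n) :
    compactD X (n + 1) (compactD X n x) = 0 := by
  obtain ⟨φ, hφ, rfl⟩ := cls_surjective x
  rw [compactD_cls, compactD_cls, cls_eq_zero, delta_delta]
  exact zero_mem _

end Quotient

/-! ### Compactly supported cohomology as cocycles modulo coboundaries -/

/-- Compactly supported cohomology as cocycles modulo coboundaries. -/
abbrev ConcreteCohomology (X : Type u) [TopologicalSpace X] (n : ℕ) : Type u :=
  Cohomology (A := Compact X) (compactD X) n

section Comparison

open CategoryTheory

/-- The homology of a short complex of modules, with boundaries written as a submodule of the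
middle term. -/
noncomputable def shortComplexHomologyEquiv (S : ShortComplex (ModuleCat.{u} ℚ))
    (b : Submodule ℚ S.X₂) (hb : LinearMap.range S.f.hom = b) :
    S.homology ≃ₗ[ℚ] (LinearMap.ker S.g.hom ⧸ b.submoduleOf (LinearMap.ker S.g.hom)) :=
  S.moduleCatHomologyIso.toLinearEquiv ≪≫ₗ
    Submodule.quotEquivOfEq _ _ (by
      subst hb
      ext ⟨x, hx⟩
      rw [LinearMap.mem_range, Submodule.submoduleOf, Submodule.mem_comap, LinearMap.mem_range]
      exact exists_congr fun y => Subtype.ext_iff)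

variable (X : Type u) [TopologicalSpace X]

theorem compactComplex_d (n : ℕ) :
    (compactComplex X).d n (n + 1) = ModuleCat.ofHom (compactDelta X n) := by
  have h := CochainComplex.of_d (V := ModuleCat.{u} ℚ) (α := ℕ)
    (fun n => ModuleCat.of ℚ (CompactCochain X n)) (fun n => ModuleCat.ofHom (compactDelta X n)) n
  exact h

/-- The categorical definition of `H_c^n` agrees with cocycles modulo coboundaries. -/
theorem nonempty_compactCohomologyEquiv (n : ℕ) :
    Nonempty (compactCohomology X n ≃ₗ[ℚ] ConcreteCohomology X n) := by
  cases n with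
  | zero =>
    have e₁ := ((compactComplex X).homologyIsoSc' 0 0 1 (by simp) (by simp)).toLinearEquiv
    have e₂ := shortComplexHomologyEquiv ((compactComplex X).sc' 0 0 1) ⊥ <| by
      change LinearMap.range ((compactComplex X).d 0 0).hom = ⊥
      rw [(compactComplex X).shape 0 0 (by simp)]
      exact LinearMap.range_zero
    have hg : ((compactComplex X).sc' 0 0 1).g = ModuleCat.ofHom (compactDelta X 0) :=
      compactComplex_d X 0
    rw [hg] at e₂
    exact ⟨e₁ ≪≫ₗ e₂⟩
  | succ n =>
    have e₁ := ((compactComplex X).homologyIsoSc' n (n + 1) (n + 2) (by simp)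
      (by simp)).toLinearEquiv
    have hf : ((compactComplex X).sc' n (n + 1) (n + 2)).f = ModuleCat.ofHom (compactDelta X n) :=
      compactComplex_d X n
    have hg : ((compactComplex X).sc' n (n + 1) (n + 2)).g =
        ModuleCat.ofHom (compactDelta X (n + 1)) := compactComplex_d X (n + 1)
    have e₂ := shortComplexHomologyEquiv ((compactComplex X).sc' n (n + 1) (n + 2))
      (LinearMap.range (compactDelta X n)) (by rw [hf]; rfl)
    rw [hg] at e₂
    exact ⟨e₁ ≪≫ₗ e₂⟩

end Comparison

/-- The space `X` has finite-dimensional total cohomology with compact supports, and its Euler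
characteristic with compact supports is `c`. -/
def HasChi (X : Type u) [TopologicalSpace X] (c : ℤ) : Prop :=
  HasEuler (ConcreteCohomology X) c

theorem HasChi.finite_and_eq {X : Type u} [TopologicalSpace X] {c : ℤ} (h : HasChi X c) :
    HasFiniteCompactCohomology X ∧ compactEulerChar X = c := by
  have e := fun n => (nonempty_compactCohomologyEquiv X n).some
  obtain ⟨hf, N, hN, hc⟩ := HasEuler.congr h fun n => (e n).symm
  refine ⟨⟨hf, (Set.finite_Iio N).subset fun n hn => ?_⟩, ?_⟩
  · by_contra h'
    exact hn (hN n (not_lt.1 h'))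
  · rw [← hc, compactEulerChar,
      HomologicalComplex.homologyEulerChar_eq_sum_finSet_of_finrankSupport_subset _
        (Finset.range N)]
    · refine Finset.sum_congr rfl fun n _ => ?_
      simp [ComplexShape.χ]
    · rw [GradedObject.finrankSupport_subset_iff]
      intro n hn
      have := hN n (by simpa using hn)
      exact Module.finrank_zero_of_subsingleton

/-! ### Cocycles and coboundaries as cochains -/

section Raw

variable {X : Type u} [TopologicalSpace X]

variable (X) in
/-- Cochains that represent coboundaries in the complex of compactly supported cochains: the sums
of a cochain with empty support and the coboundary of a compactly supported cochain. -/
def boundaries : ∀ n, Submodule ℚ (Cochain X n)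
  | 0 => locallyZero X 0
  | n + 1 => locallyZero X (n + 1) ⊔ (compactlySupported X n).map (delta X n)

theorem locallyZero_le_boundaries (n : ℕ) : locallyZero X n ≤ boundaries X n := by
  cases n with
  | zero => exact le_rfl
  | succ n => exact le_sup_left

theorem mem_boundaries_succ {n : ℕ} {φ : Cochain X (n + 1)} : φ ∈ boundaries X (n + 1) ↔
    ∃ η ∈ compactlySupported X n, φ - delta X n η ∈ locallyZero X (n + 1) := by
  rw [boundaries, Submodule.mem_sup]
  constructor
  · rintro ⟨ψ, hψ, _, ⟨η, hη, rfl⟩, rfl⟩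
    exact ⟨η, hη, by rwa [add_sub_cancel_right]⟩
  · rintro ⟨η, hη, h⟩
    exact ⟨_, h, _, ⟨η, hη, rfl⟩, sub_add_cancel _ _⟩

theorem cls_mem_coboundaries {n : ℕ} {φ : Cochain X n} (hφ : φ ∈ compactlySupported X n) :
    cls φ hφ ∈ coboundaries (A := Compact X) (compactD X) n ↔
      φ ∈ boundaries X n := by
  cases n with
  | zero => exact cls_eq_zero hφ
  | succ n =>
    rw [mem_boundaries_succ]
    constructor
    · rintro ⟨x, hx⟩
      obtain ⟨η, hη, rfl⟩ := cls_surjective x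
      rw [compactD_cls] at hx
      exact ⟨η, hη, (cls_eq _ _).1 hx.symm⟩
    · rintro ⟨η, hη, h⟩
      refine ⟨cls η hη, ?_⟩
      rw [compactD_cls]
      exact ((cls_eq _ _).2 h).symm

/-- Cohomology vanishes as soon as every cocycle is a coboundary. -/
theorem subsingleton_cohomology {n : ℕ} (h : ∀ φ : Cochain X n, φ ∈ compactlySupported X n →
    delta X n φ ∈ locallyZero X (n + 1) → φ ∈ boundaries X n) :
    Subsingleton (ConcreteCohomology X n) := by
  refine subsingleton_of_forall_eq 0 fun x => ?_
  obtain ⟨y, hy, rfl⟩ := mk_surjective x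
  obtain ⟨φ, hφ, rfl⟩ := cls_surjective y
  rw [mk_eq_zero, cls_mem_coboundaries]
  rw [compactD_cls, cls_eq_zero] at hy
  exact h φ hφ hy

end Raw

/-! ### Pulling back cochains -/

section Pull

variable {X : Type u} {Y : Type v}

/-- The pullback of a cochain along an arbitrary function. -/
def pull (f : Y → X) (n : ℕ) : Cochain X n →ₗ[ℚ] Cochain Y n where
  toFun φ y := φ (f ∘ y)
  map_add' _ _ := rfl
  map_smul' _ _ := rfl

theorem pull_apply (f : Y → X) {n : ℕ} (φ : Cochain X n) (y : Fin (n + 1) → Y) :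
    pull f n φ y = φ (f ∘ y) := rfl

theorem delta_apply {n : ℕ} (φ : Cochain X n) (x : Fin (n + 2) → X) :
    delta X n φ x = ∑ i : Fin (n + 2), (-1 : ℚ) ^ (i : ℕ) * φ (i.removeNth x) := rfl

theorem delta_pull (f : Y → X) {n : ℕ} (φ : Cochain X n) :
    delta Y n (pull f n φ) = pull f (n + 1) (delta X n φ) := rfl

/-- The cochain `φ` vanishes on all tuples of points of `A`. -/
def VanishesOn {n : ℕ} (φ : Cochain X n) (A : Set X) : Prop :=
  ∀ x : Fin (n + 1) → X, (∀ i, x i ∈ A) → φ x = 0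

theorem VanishesOn.pull {n : ℕ} {φ : Cochain X n} {A : Set X} {B : Set Y} {f : Y → X}
    (h : VanishesOn φ A) (hf : Set.MapsTo f B A) : VanishesOn (pull f n φ) B :=
  fun _ hy => h _ fun i => hf (hy i)

variable [TopologicalSpace X] [TopologicalSpace Y]

theorem zeroNear_pull {n : ℕ} {φ : Cochain X n} {f : Y → X} {p : Y} (hf : ContinuousAt f p)
    (h : ZeroNear φ (f p)) : ZeroNear (pull f n φ) p := by
  obtain ⟨V, hV, h⟩ := h
  exact ⟨f ⁻¹' V, hf hV, fun y hy => h _ hy⟩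

theorem pull_mem_locallyZero {n : ℕ} {φ : Cochain X n} {f : Y → X} (hf : Continuous f)
    (h : φ ∈ locallyZero X n) : pull f n φ ∈ locallyZero Y n :=
  fun p => zeroNear_pull hf.continuousAt (h (f p))

theorem pull_mem_compactlySupported {n : ℕ} {φ : Cochain X n} (f : Y ≃ₜ X)
    (h : φ ∈ compactlySupported X n) : pull f n φ ∈ compactlySupported Y n := by
  refine IsCompact.of_isClosed_subset (f.isCompact_preimage.2 h) (isClosed_support _)
    fun p hp h' => hp ?_
  exact zeroNear_pull f.continuous.continuousAt h'

/-- Homeomorphic spaces have isomorphic complexes of compactly supported cochains. -/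
noncomputable def compactCochainEquiv (f : Y ≃ₜ X) (n : ℕ) :
    Compact X n ≃ₗ[ℚ] Compact Y n :=
  LinearEquiv.ofLinearMap
    (quotMap (pull f n) (fun _ => pull_mem_compactlySupported f)
      fun _ => pull_mem_locallyZero f.continuous)
    (quotMap (pull f.symm n) (fun _ => pull_mem_compactlySupported f.symm)
      fun _ => pull_mem_locallyZero f.symm.continuous)
    (by
      refine LinearMap.ext fun x => ?_
      obtain ⟨φ, hφ, rfl⟩ := cls_surjective x
      rw [LinearMap.comp_apply, quotMap_cls, quotMap_cls]
      simp only [LinearMap.id_apply]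
      congr 1
      funext y
      rw [pull_apply, pull_apply]
      congr 1
      funext i
      exact f.symm_apply_apply _)
    (by
      refine LinearMap.ext fun x => ?_
      obtain ⟨φ, hφ, rfl⟩ := cls_surjective x
      rw [LinearMap.comp_apply, quotMap_cls, quotMap_cls]
      simp only [LinearMap.id_apply]
      congr 1
      funext y
      rw [pull_apply, pull_apply]
      congr 1
      funext i
      exact f.apply_symm_apply _)

theorem HasChi.congr {c : ℤ} (h : HasChi X c) (f : X ≃ₜ Y) : HasChi Y c :=
  HasEuler.congr h fun n => cohomologyEquiv (A := Compact X) (B := Compact Y)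
    (fun n => compactCochainEquiv f.symm n) (fun n x => by
      obtain ⟨φ, hφ, rfl⟩ := cls_surjective x
      rfl) n

end Pull

/-! ### The empty space and the point -/

theorem hasChi_of_isEmpty (X : Type u) [TopologicalSpace X] [IsEmpty X] : HasChi X 0 :=
  hasEuler_zero fun _ => subsingleton_cohomology fun _ _ _ =>
    locallyZero_le_boundaries _ fun p => isEmptyElim p

section Point

theorem delta_of_unique {X : Type u} [Unique X] {n : ℕ} (φ : Cochain X n) (x : Fin (n + 2) → X) :
    delta X n φ x = if Even n then 0 else φ fun _ => default := by
  have h : ∀ i : Fin (n + 2), i.removeNth x = fun _ => default := fun i => Subsingleton.elim _ _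
  simp only [delta_apply, h, ← Finset.sum_mul]
  rw [Fin.sum_univ_eq_sum_range (fun i => (-1 : ℚ) ^ i) (n + 2), Finset.sum_range_succ,
    neg_one_geom_sum]
  rcases Nat.even_or_odd n with hn | hn
  · simp [hn, Nat.even_add_one, hn.add_one.neg_one_pow]
  · simp [Nat.not_even_iff_odd.2 hn, Nat.even_add_one, hn.add_one.neg_one_pow]

variable {X : Type u} [TopologicalSpace X] [Unique X]

theorem mem_compactlySupported_of_unique {n : ℕ} (φ : Cochain X n) :
    φ ∈ compactlySupported X n :=
  Set.Finite.isCompact (Set.toFinite _)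

theorem mem_locallyZero_of_unique {n : ℕ} {φ : Cochain X n} :
    φ ∈ locallyZero X n ↔ φ (fun _ => default) = 0 := by
  constructor
  · intro h
    obtain ⟨V, hV, h⟩ := h default
    exact h _ fun _ => mem_of_mem_nhds hV
  · exact fun h p => ⟨Set.univ, Filter.univ_mem, fun x _ => by
      rwa [Subsingleton.elim x fun _ => default]⟩

/-- On a point the coboundary is zero in even degrees and bijective in odd degrees, so that only
`H^0 = ℚ` survives. -/
theorem hasChi_of_unique : HasChi X 1 := by
  have hpos : ∀ n, 1 ≤ n → Subsingleton (ConcreteCohomology X n) := fun n hn => by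
    obtain ⟨n, rfl⟩ : ∃ m, n = m + 1 := ⟨n - 1, by lia⟩
    refine subsingleton_cohomology fun φ _ hδ => ?_
    rw [mem_locallyZero_of_unique, delta_of_unique] at hδ
    rcases Nat.even_or_odd n with hn | hn
    · rw [if_neg (by simpa [Nat.even_add_one] using hn)] at hδ
      exact locallyZero_le_boundaries _ (mem_locallyZero_of_unique.2 hδ)
    · refine mem_boundaries_succ.2 ⟨fun _ => φ fun _ => default,
        mem_compactlySupported_of_unique _, mem_locallyZero_of_unique.2 ?_⟩
      rw [Pi.sub_apply, delta_of_unique, if_neg (Nat.not_even_iff_odd.2 hn), sub_self]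
  -- evaluation at the constant tuple identifies `H^0` with `ℚ`
  let T : Cochain X 0 →ₗ[ℚ] ℚ := LinearMap.proj (R := ℚ) (φ := fun _ : Fin 1 → X => ℚ)
    fun _ => default
  have hT : ∀ φ, T φ = φ fun _ => default := fun _ => rfl
  let T₁ : Compact X 0 →ₗ[ℚ] ℚ :=
    Submodule.liftQ _ (T ∘ₗ (compactlySupported X 0).subtype) fun φ hφ =>
      mem_locallyZero_of_unique.1 hφ
  have hT₁ : ∀ (φ) (hφ : φ ∈ compactlySupported X 0), T₁ (cls φ hφ) = T φ :=
    fun _ _ => rfl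
  let T₂ : ConcreteCohomology X 0 →ₗ[ℚ] ℚ :=
    Submodule.liftQ _ (T₁ ∘ₗ (LinearMap.ker (compactD X 0)).subtype) fun x hx => by
      have h : (x : Compact X 0) = 0 := hx
      rw [LinearMap.mem_ker, LinearMap.comp_apply, Submodule.subtype_apply, h, map_zero]
  have hT₂ : ∀ x hx, T₂ (mk x hx) = T₁ x := fun _ _ => rfl
  have e : ConcreteCohomology X 0 ≃ₗ[ℚ] ℚ := LinearEquiv.ofBijective T₂ <| by
    constructor
    · rw [injective_iff_map_eq_zero]
      intro x hx
      obtain ⟨y, hy, rfl⟩ := mk_surjective x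
      obtain ⟨φ, hφ, rfl⟩ := cls_surjective y
      rw [hT₂, hT₁, hT] at hx
      rw [mk_eq_zero, cls_mem_coboundaries]
      exact mem_locallyZero_of_unique.2 hx
    · intro q
      refine ⟨mk (cls (fun _ => q) (mem_compactlySupported_of_unique _)) ?_, rfl⟩
      rw [compactD_cls, cls_eq_zero, mem_locallyZero_of_unique, delta_of_unique,
        if_pos Even.zero]
  refine ⟨fun n => ?_, 1, hpos, ?_⟩
  · cases n with
    | zero => exact Module.Finite.equiv e.symm
    | succ n =>
      have := hpos (n + 1) (by lia)
      infer_instance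
  · simp [e.finrank_eq]

end Point

/-! ### The prism operator -/

section Prism

variable {X : Type u} {Y : Type v}

/-- The coboundary on functions of `n` points, where also `n = 0` is allowed. -/
def augDelta {n : ℕ} (φ : (Fin n → X) → ℚ) (x : Fin (n + 1) → X) : ℚ :=
  ∑ i : Fin (n + 1), (-1 : ℚ) ^ (i : ℕ) * φ (i.removeNth x)

theorem augDelta_cons {n : ℕ} (φ : (Fin (n + 1) → X) → ℚ) (a : X) (x : Fin (n + 1) → X) :
    augDelta φ (Fin.cons a x) = φ x - augDelta (fun z => φ (Fin.cons a z)) x := by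
  rw [augDelta, Fin.sum_univ_succ, augDelta, sub_eq_add_neg, ← Finset.sum_neg_distrib]
  congr 1
  · simp [Fin.removeNth_zero]
  · refine Finset.sum_congr rfl fun i _ => ?_
    have h : i.succ.removeNth (Fin.cons a x : Fin (n + 2) → X) = Fin.cons a (i.removeNth x) := by
      funext j
      cases j using Fin.cases <;> simp [Fin.removeNth]
    rw [h, Fin.val_succ, pow_succ]
    ring

theorem augDelta_sub {n : ℕ} (φ ψ : (Fin n → X) → ℚ) (x : Fin (n + 1) → X) :
    augDelta (fun z => φ z - ψ z) x = augDelta φ x - augDelta ψ x := by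
  simp [augDelta, mul_sub, Finset.sum_sub_distrib]

/-- The prism operator for two functions `f` and `g`: the alternating sum of
`φ (f y₀, …, f yᵢ, g yᵢ, …, g yₙ₋₁)`, defined by recursion on the first point. -/
def prism (f g : Y → X) : ∀ n, ((Fin (n + 1) → X) → ℚ) → (Fin n → Y) → ℚ
  | 0, _, _ => 0
  | n + 1, φ, y => φ (Fin.cons (f (y 0)) (g ∘ y)) -
      prism f g n (fun z => φ (Fin.cons (f (y 0)) z)) (Fin.tail y)

theorem prism_sub (f g : Y → X) {n : ℕ} (φ ψ : (Fin (n + 1) → X) → ℚ) (y : Fin n → Y) :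
    prism f g n (fun z => φ z - ψ z) y = prism f g n φ y - prism f g n ψ y := by
  induction n with
  | zero => simp [prism]
  | succ n ih =>
    simp only [prism, ih]
    ring

theorem prism_eq_zero {f g : Y → X} {n : ℕ} {φ : (Fin (n + 1) → X) → ℚ} {A : Set X}
    (h : ∀ x, (∀ i, x i ∈ A) → φ x = 0) {y : Fin n → Y} (hf : ∀ i, f (y i) ∈ A)
    (hg : ∀ i, g (y i) ∈ A) : prism f g n φ y = 0 := by
  induction n with
  | zero => rfl
  | succ n ih =>
    rw [prism, h, ih, sub_zero]
    · intro x hx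
      refine h _ fun i => ?_
      cases i using Fin.cases with
      | zero => exact hf 0
      | succ i => exact hx i
    · exact fun i => hf i.succ
    · exact fun i => hg i.succ
    · intro i
      cases i using Fin.cases with
      | zero => exact hf 0
      | succ i => exact hg i

/-- The prism operator is a chain homotopy between the pullbacks along `f` and `g`. -/
theorem augDelta_prism (f g : Y → X) {n : ℕ} (φ : (Fin (n + 1) → X) → ℚ) (y : Fin (n + 1) → Y) :
    augDelta (prism f g n φ) y + prism f g (n + 1) (augDelta φ) y = φ (g ∘ y) - φ (f ∘ y) := by
  induction n with
  | zero =>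
    have h0 : augDelta (prism f g 0 φ) y = 0 := by simp [augDelta, prism]
    have h1 : augDelta (fun z => φ (Fin.cons (f (y 0)) z)) (g ∘ y) = φ (f ∘ y) := by
      rw [augDelta, Fin.sum_univ_succ]
      simp only [Fin.val_zero, pow_zero, one_mul, Finset.univ_eq_empty, Finset.sum_empty, add_zero]
      congr 1
      funext i
      cases i using Fin.cases with
      | zero => rfl
      | succ i => exact i.elim0
    rw [h0, prism, augDelta_cons, prism, h1]
    ring
  | succ n ih =>
    have ih' := ih (fun z => φ (Fin.cons (f (y 0)) z)) (Fin.tail y)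
    have hf : (Fin.cons (f (y 0)) (f ∘ Fin.tail y) : Fin (n + 2) → X) = f ∘ y := by
      funext i
      cases i using Fin.cases <;> rfl
    have hg : (Fin.cons (g (y 0)) (g ∘ Fin.tail y) : Fin (n + 2) → X) = g ∘ y := by
      funext i
      cases i using Fin.cases <;> rfl
    have e1 : augDelta (prism f g (n + 1) φ) y = prism f g (n + 1) φ (Fin.tail y) -
        augDelta (fun z => prism f g (n + 1) φ (Fin.cons (y 0) z)) (Fin.tail y) := by
      conv_lhs => rw [← Fin.cons_self_tail y]
      rw [augDelta_cons]
    have e2 : (fun z : Fin n → Y => prism f g (n + 1) φ (Fin.cons (y 0) z)) = fun z =>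
        φ (Fin.cons (f (y 0)) (Fin.cons (g (y 0)) (g ∘ z))) -
          prism f g n (fun z => φ (Fin.cons (f (y 0)) z)) z := by
      funext z
      rw [prism]
      simp only [Fin.cons_zero, Fin.tail_cons]
      congr 3
      funext i
      cases i using Fin.cases <;> rfl
    have e3 : augDelta (fun z : Fin n → Y =>
        φ (Fin.cons (f (y 0)) (Fin.cons (g (y 0)) (g ∘ z)))) (Fin.tail y) =
        augDelta (fun z : Fin n → X => φ (Fin.cons (f (y 0)) (Fin.cons (g (y 0)) z)))
          (g ∘ Fin.tail y) := rfl
    have e4 : augDelta φ (Fin.cons (f (y 0)) (g ∘ y)) = φ (g ∘ y) -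
        (φ (Fin.cons (f (y 0)) (g ∘ Fin.tail y)) -
        augDelta (fun z : Fin n → X => φ (Fin.cons (f (y 0)) (Fin.cons (g (y 0)) z)))
          (g ∘ Fin.tail y)) := by
      rw [augDelta_cons, ← hg, augDelta_cons]
    have e5 : (fun z : Fin (n + 2) → X => augDelta φ (Fin.cons (f (y 0)) z)) = fun z =>
        φ z - augDelta (fun z => φ (Fin.cons (f (y 0)) z)) z := by
      funext z
      rw [augDelta_cons]
    have e6 : prism f g (n + 2) (augDelta φ) y = augDelta φ (Fin.cons (f (y 0)) (g ∘ y)) -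
        prism f g (n + 1) (fun z => augDelta φ (Fin.cons (f (y 0)) z)) (Fin.tail y) := rfl
    rw [e1, e2, augDelta_sub, e3, e6, e4, e5, prism_sub, ← hf]
    linear_combination ih'

/-- If `δ φ` vanishes on the values that `f` and `g` take on `W`, then on tuples of points of `W` the
prism operator provides a primitive of the difference of the two pullbacks. -/
theorem sub_eq_augDelta_prism {n : ℕ} {φ : Cochain X n} {f g : Y → X} {W : Set Y} {A : Set X}
    (h : VanishesOn (delta X n φ) A) (hf : ∀ y ∈ W, f y ∈ A) (hg : ∀ y ∈ W, g y ∈ A)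
    (y : Fin (n + 1) → Y) (hy : ∀ i, y i ∈ W) :
    pull g n φ y - pull f n φ y = augDelta (prism f g n φ) y := by
  have h' : prism f g (n + 1) (augDelta φ) y = 0 :=
    prism_eq_zero h (fun i => hf _ (hy i)) (fun i => hg _ (hy i))
  rw [pull_apply, pull_apply, ← augDelta_prism f g φ y, h', add_zero]

variable [TopologicalSpace Y]

theorem pull_sub_pull_mem_locallyZero {φ : Cochain X 0} {f g : Y → X}
    (hδ : ∀ p, ∃ W ∈ 𝓝 p, ∃ A, VanishesOn (delta X 0 φ) A ∧ (∀ y ∈ W, f y ∈ A) ∧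
      ∀ y ∈ W, g y ∈ A) :
    pull g 0 φ - pull f 0 φ ∈ locallyZero Y 0 := fun p => by
  obtain ⟨W, hW, A, hA, hf, hg⟩ := hδ p
  refine ⟨W, hW, fun y hy => ?_⟩
  rw [Pi.sub_apply, sub_eq_augDelta_prism hA hf hg y hy]
  simp [augDelta, prism]

theorem pull_sub_pull_sub_delta_prism_mem_locallyZero {n : ℕ} {φ : Cochain X (n + 1)} {f g : Y → X}
    (hδ : ∀ p, ∃ W ∈ 𝓝 p, ∃ A, VanishesOn (delta X (n + 1) φ) A ∧ (∀ y ∈ W, f y ∈ A) ∧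
      ∀ y ∈ W, g y ∈ A) :
    pull g (n + 1) φ - pull f (n + 1) φ - delta Y n (prism f g (n + 1) φ) ∈
      locallyZero Y (n + 1) := fun p => by
  obtain ⟨W, hW, A, hA, hf, hg⟩ := hδ p
  refine ⟨W, hW, fun y hy => ?_⟩
  rw [Pi.sub_apply, Pi.sub_apply, sub_eq_augDelta_prism hA hf hg y hy, sub_eq_zero]
  rfl

theorem zeroNear_prism {n : ℕ} {φ : Cochain X (n + 1)} {f g : Y → X} {p : Y}
    (h : ∃ W ∈ 𝓝 p, ∃ A, VanishesOn φ A ∧ (∀ y ∈ W, f y ∈ A) ∧ ∀ y ∈ W, g y ∈ A) :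
    ZeroNear (n := n) (prism f g (n + 1) φ) p := by
  obtain ⟨W, hW, A, hA, hf, hg⟩ := h
  exact ⟨W, hW, fun y hy => prism_eq_zero hA (fun i => hf _ (hy i)) fun i => hg _ (hy i)⟩

theorem mem_compactlySupported_of_zeroNear {n : ℕ} {φ : Cochain Y n} {K : Set Y}
    (hK : IsCompact K) (h : ∀ p ∉ K, ZeroNear φ p) : φ ∈ compactlySupported Y n :=
  hK.of_isClosed_subset (isClosed_support _) fun p hp => by_contra fun hpK => hp (h p hpK)

/-- Two functions `f` and `g`, not necessarily continuous, pull back the cochain `φ` to cohomologous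
cochains if near every point their values are so close together that `δ φ` vanishes on them; outside
a compact set they must in addition be so close that `φ` vanishes on them. -/
theorem pull_sub_pull_mem_boundaries {n : ℕ} {φ : Cochain X n} {f g : Y → X}
    (hδ : ∀ p, ∃ W ∈ 𝓝 p, ∃ A, VanishesOn (delta X n φ) A ∧ (∀ y ∈ W, f y ∈ A) ∧ ∀ y ∈ W, g y ∈ A)
    {K : Set Y} (hK : IsCompact K)
    (hφ : ∀ p ∉ K, ∃ W ∈ 𝓝 p, ∃ A, VanishesOn φ A ∧ (∀ y ∈ W, f y ∈ A) ∧ ∀ y ∈ W, g y ∈ A) :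
    pull g n φ - pull f n φ ∈ boundaries Y n := by
  cases n with
  | zero => exact pull_sub_pull_mem_locallyZero hδ
  | succ n =>
    exact mem_boundaries_succ.2 ⟨prism f g (n + 1) φ,
      mem_compactlySupported_of_zeroNear hK fun p hp => zeroNear_prism (hφ p hp),
      pull_sub_pull_sub_delta_prism_mem_locallyZero hδ⟩

end Prism

/-! ### Retracting a neighbourhood of a closed subset -/

/-- In a locally compact Hausdorff space, a neighbourhood of `Z ∩ S` can be retracted, by a function
that is not necessarily continuous, onto the closed set `Z`, moving points as little as prescribed
by the neighbourhoods `V q`. -/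
theorem exists_small_retraction {X : Type u} [TopologicalSpace X] [T2Space X]
    [LocallyCompactSpace X] (Z : Set X) {S : Set X} (hS : IsCompact S)
    {V : X → Set X} (hV : ∀ q, V q ∈ 𝓝 q) :
    ∃ f : X → X, (∀ z ∈ Z, f z = z) ∧ ∀ p, ∃ W ∈ 𝓝 p, ∃ q, (∀ y ∈ W, y ∈ V q) ∧
      (∀ y ∈ W, f y ∈ V q) ∧ (p ∈ Z → p ∈ S → ∀ y ∈ W, f y ∈ Z) := by
  classical
  have : CompletelyRegularSpace X :=
    OnePoint.isOpenEmbedding_coe.isInducing.completelyRegularSpace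
  obtain ⟨uX, rfl⟩ := CompletelyRegularSpace.exists_uniformSpace (X := X)
  obtain ⟨L, hL, hSL⟩ := exists_compact_superset hS
  obtain ⟨E, hE, hEV⟩ := lebesgue_number_lemma_nhds (K := L) hL fun x _ => hV x
  obtain ⟨D, hD, hDsymm, hDE⟩ := comp_symm_mem_uniformity_sets hE
  have hDsub : ∀ x y, (x, y) ∈ D → (x, y) ∈ E := fun x y h =>
    hDE ⟨y, h, refl_mem_uniformity hD⟩
  let f : X → X := fun x => if x ∈ Z then x else
    if h : x ∈ L ∧ ∃ z ∈ Z, (x, z) ∈ D then h.2.choose else x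
  have hf1 : ∀ z ∈ Z, f z = z := fun z hz => if_pos hz
  have hf2 : ∀ x ∈ L, (∃ z ∈ Z, (x, z) ∈ D) → f x ∈ Z := fun x hx h => by
    by_cases hxZ : x ∈ Z
    · rwa [hf1 x hxZ]
    · simp only [f, if_neg hxZ, dif_pos (And.intro hx h)]
      exact h.choose_spec.1
  have hf3 : ∀ x, (x, f x) ∈ D := fun x => by
    by_cases hxZ : x ∈ Z
    · rw [hf1 x hxZ]; exact refl_mem_uniformity hD
    · simp only [f, if_neg hxZ]
      split_ifs with h
      · exact h.2.choose_spec.2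
      · exact refl_mem_uniformity hD
  have hf4 : ∀ x ∉ L, f x = x := fun x hx => by
    simp only [f]
    split_ifs with h1 h2
    · rfl
    · exact absurd h2.1 hx
    · rfl
  refine ⟨f, hf1, fun p => ?_⟩
  by_cases hp : p ∈ L
  · obtain ⟨q, hq⟩ := hEV p hp
    have hb : UniformSpace.ball p D ∈ 𝓝 p := UniformSpace.ball_mem_nhds p hD
    have h1 : ∀ y ∈ UniformSpace.ball p D, y ∈ V q := fun y hy => hq (hDsub _ _ hy)
    have h2 : ∀ y ∈ UniformSpace.ball p D, f y ∈ V q := fun y hy =>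
      hq (hDE ⟨y, hy, hf3 y⟩)
    by_cases hpS : p ∈ S
    · refine ⟨UniformSpace.ball p D ∩ L, Filter.inter_mem hb (mem_interior_iff_mem_nhds.1 (hSL hpS)),
        q, fun y hy => h1 y hy.1, fun y hy => h2 y hy.1, fun hpZ _ y hy => ?_⟩
      exact hf2 y hy.2 ⟨p, hpZ, hDsymm.symm _ _ hy.1⟩
    · exact ⟨_, hb, q, h1, h2, fun _ h => absurd h hpS⟩
  · refine ⟨V p ∩ Lᶜ, Filter.inter_mem (hV p) (hL.isClosed.isOpen_compl.mem_nhds hp), p,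
      fun y hy => hy.1, fun y hy => ?_, fun _ h => absurd (interior_subset (hSL h)) hp⟩
    rw [hf4 y hy.2]; exact hy.1

/-! ### The long exact sequence of a closed subset -/

section Extend

variable {X : Type u}

open Classical in
/-- Extension of a cochain on a subset by zero, where only tuples with all points in `T` are
retained. -/
noncomputable def extendZero (S : Set X) {n : ℕ} (φ : Cochain S n) (T : Set X) : Cochain X n :=
  fun x => if h : ∀ i, x i ∈ S ∩ T then φ fun i => ⟨x i, (h i).1⟩ else 0

theorem extendZero_apply {S : Set X} {n : ℕ} (φ : Cochain S n) {T : Set X} (x : Fin (n + 1) → S)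
    (h : ∀ i, (x i : X) ∈ T) : extendZero S φ T (fun i => x i) = φ x :=
  dif_pos fun i => ⟨(x i).2, h i⟩

theorem extendZero_eq_zero {S : Set X} {n : ℕ} (φ : Cochain S n) {T : Set X} {x : Fin (n + 1) → X}
    {i} (h : x i ∉ T) : extendZero S φ T x = 0 :=
  dif_neg fun h' => h (h' i).2

theorem extendZero_eq_zero_of_forall {S : Set X} {n : ℕ} {φ : Cochain S n} {T : Set X}
    {x : Fin (n + 1) → X} (h : ∀ y : Fin (n + 1) → S, (∀ i, (y i : X) = x i) → φ y = 0) :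
    extendZero S φ T x = 0 := by
  rw [extendZero]
  split_ifs with h'
  · exact h _ fun _ => rfl
  · rfl

end Extend

section ClosedSubset

variable {X : Type u} [TopologicalSpace X]

/-- Compactly supported cochains whose support does not meet `Z`. -/
def supportedOff (Z : Set X) (n : ℕ) : Submodule ℚ (Cochain X n) where
  carrier := {φ | φ ∈ compactlySupported X n ∧ ∀ z ∈ Z, ZeroNear φ z}
  zero_mem' := ⟨zero_mem _, fun _ _ => ⟨Set.univ, Filter.univ_mem, fun _ _ => rfl⟩⟩
  add_mem' hφ hψ := ⟨add_mem hφ.1 hψ.1, fun z hz => (hφ.2 z hz).add (hψ.2 z hz)⟩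
  smul_mem' c _ hφ := ⟨Submodule.smul_mem _ c hφ.1, fun z hz => (hφ.2 z hz).smul c⟩

theorem delta_mem_supportedOff {Z : Set X} {n : ℕ} {φ : Cochain X n} (hφ : φ ∈ supportedOff Z n) :
    delta X n φ ∈ supportedOff Z (n + 1) :=
  ⟨delta_mem_compactlySupported X n φ hφ.1, fun z hz => (hφ.2 z hz).delta⟩

/-- Compactly supported cochains with support disjoint from `Z`, modulo cochains with empty
support. -/
abbrev OffCochain (Z : Set X) (n : ℕ) : Type u := QuotCochain (supportedOff Z n)

/-- The coboundary on cochains supported off `Z`. -/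
def offDelta (Z : Set X) (n : ℕ) : OffCochain Z n →ₗ[ℚ] OffCochain Z (n + 1) :=
  quotMap (delta X n) (fun _ hφ => delta_mem_supportedOff hφ) delta_mem_locallyZero

theorem offDelta_cls {Z : Set X} {n : ℕ} {φ : Cochain X n} (hφ : φ ∈ supportedOff Z n) :
    offDelta Z n (cls φ hφ) = cls (delta X n φ) (delta_mem_supportedOff hφ) := rfl

/-! #### Restriction to the open complement -/

theorem zeroNear_of_zeroNear_val {S : Set X} (hS : IsOpen S) {n : ℕ} {φ : Cochain X n} {p : S}
    (h : ZeroNear (pull (Subtype.val : S → X) n φ) p) : ZeroNear φ (p : X) := by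
  obtain ⟨V, hV, h⟩ := h
  refine ⟨Subtype.val '' V, hS.isOpenMap_subtype_val.image_mem_nhds hV, fun x hx => ?_⟩
  choose y hy hyx using hx
  obtain rfl : Subtype.val ∘ y = x := funext hyx
  exact h y hy

theorem pull_val_mem_compactlySupported_of_supportedOff {Z : Set X} {n : ℕ}
    {φ : Cochain X n} (hφ : φ ∈ supportedOff Z n) :
    pull (Subtype.val : (Zᶜ : Set X) → X) n φ ∈ compactlySupported (Zᶜ : Set X) n := by
  have h : IsCompact ((Subtype.val : (Zᶜ : Set X) → X) ⁻¹' support φ) := by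
    refine Topology.IsInducing.subtypeVal.isCompact_preimage' hφ.1 fun p hp => ?_
    rw [Subtype.range_val]
    exact fun hpZ => hp (hφ.2 p hpZ)
  exact mem_compactlySupported_of_zeroNear h fun p hp =>
    zeroNear_pull continuous_subtype_val.continuousAt (not_not.1 hp)

/-- Restriction to the complement of `Z`. -/
def offRestrict (Z : Set X) (n : ℕ) :
    OffCochain Z n →ₗ[ℚ] Compact (Zᶜ : Set X) n :=
  quotMap (pull (Subtype.val : (Zᶜ : Set X) → X) n)
    (fun _ hφ => pull_val_mem_compactlySupported_of_supportedOff hφ)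
    fun _ hφ => pull_mem_locallyZero continuous_subtype_val hφ

theorem offRestrict_cls {Z : Set X} {n : ℕ} {φ : Cochain X n}
    (hφ : φ ∈ supportedOff Z n) : offRestrict Z n (cls φ hφ) =
      cls _ (pull_val_mem_compactlySupported_of_supportedOff hφ) := rfl

theorem offRestrict_injective {Z : Set X} (hZ : IsClosed Z) (n : ℕ) :
    Function.Injective (offRestrict Z n) := by
  rw [injective_iff_map_eq_zero]
  intro x hx
  obtain ⟨φ, hφ, rfl⟩ := cls_surjective x
  rw [offRestrict_cls, cls_eq_zero] at hx
  rw [cls_eq_zero]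
  intro p
  by_cases hp : p ∈ Z
  · exact hφ.2 p hp
  · exact zeroNear_of_zeroNear_val hZ.isOpen_compl (hx ⟨p, hp⟩)

/-- Extension by zero needs to be preceded by cutting off outside a compact neighbourhood of the
support: otherwise the result need not vanish near points of `Z`, because tuples of points close
to `Z` may be spread out in the complement of `Z`. -/
theorem offRestrict_surjective [T2Space X] [LocallyCompactSpace X] {Z : Set X} (hZ : IsClosed Z)
    (n : ℕ) : Function.Surjective (offRestrict Z n) := by
  intro y
  obtain ⟨ψ, hψ, rfl⟩ := cls_surjective y
  have hK : IsCompact (Subtype.val '' support ψ : Set X) :=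
    IsCompact.image hψ continuous_subtype_val
  obtain ⟨T, hT, hKT, hTZ⟩ := exists_compact_between hK hZ.isOpen_compl (by
    rintro _ ⟨p, -, rfl⟩; exact p.2)
  have hzero : ∀ p ∉ T, ZeroNear (extendZero Zᶜ ψ T) p := fun p hp =>
    ⟨Tᶜ, hT.isClosed.isOpen_compl.mem_nhds hp, fun x hx => extendZero_eq_zero ψ (hx 0)⟩
  have hφ : extendZero Zᶜ ψ T ∈ supportedOff Z n :=
    ⟨mem_compactlySupported_of_zeroNear hT hzero, fun z hz => hzero z fun h => hTZ h hz⟩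
  refine ⟨cls _ hφ, ?_⟩
  rw [offRestrict_cls, cls_eq]
  intro p
  by_cases hp : p ∈ support ψ
  · have hpT : (p : X) ∈ interior T := hKT ⟨p, hp, rfl⟩
    refine ⟨Subtype.val ⁻¹' T, continuous_subtype_val.continuousAt
      (mem_interior_iff_mem_nhds.1 hpT), fun x hx => ?_⟩
    rw [Pi.sub_apply, pull_apply, sub_eq_zero]
    exact extendZero_apply ψ x hx
  · obtain ⟨V, hV, h⟩ := not_not.1 hp
    refine ⟨V, hV, fun x hx => ?_⟩
    rw [Pi.sub_apply, pull_apply, h x hx, sub_zero]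
    refine extendZero_eq_zero_of_forall fun y hy => ?_
    rw [show y = x from funext fun i => Subtype.ext (hy i), h x hx]

/-! #### Restriction to the closed subset -/

theorem pull_val_mem_compactlySupported {Z : Set X} (hZ : IsClosed Z) {n : ℕ}
    {φ : Cochain X n} (hφ : φ ∈ compactlySupported X n) :
    pull (Subtype.val : Z → X) n φ ∈ compactlySupported Z n :=
  mem_compactlySupported_of_zeroNear (hZ.isClosedEmbedding_subtypeVal.isCompact_preimage hφ)
    fun _ hp => zeroNear_pull continuous_subtype_val.continuousAt (not_not.1 hp)

/-- Restriction of compactly supported cochains to a closed subset. -/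
def restrict {Z : Set X} (hZ : IsClosed Z) (n : ℕ) : Compact X n →ₗ[ℚ] Compact Z n :=
  quotMap (pull Subtype.val n) (fun _ hφ => pull_val_mem_compactlySupported hZ hφ)
    fun _ hφ => pull_mem_locallyZero continuous_subtype_val hφ

theorem restrict_compactD {Z : Set X} (hZ : IsClosed Z) (n : ℕ) (x : Compact X n) :
    restrict hZ (n + 1) (compactD X n x) = compactD Z n (restrict hZ n x) := by
  obtain ⟨φ, hφ, rfl⟩ := cls_surjective x
  rfl

theorem restrict_surjective {Z : Set X} (hZ : IsClosed Z) (n : ℕ) :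
    Function.Surjective (restrict hZ n) := by
  intro y
  obtain ⟨ψ, hψ, rfl⟩ := cls_surjective y
  have hφ : extendZero Z ψ Set.univ ∈ compactlySupported X n := by
    refine mem_compactlySupported_of_zeroNear (IsCompact.image hψ continuous_subtype_val)
      fun p hp => ?_
    by_cases hpZ : p ∈ Z
    · have hpψ : (⟨p, hpZ⟩ : Z) ∉ support ψ := fun h => hp ⟨_, h, rfl⟩
      obtain ⟨V, hV, h⟩ := not_not.1 hpψ
      obtain ⟨W, hW, hWV⟩ := mem_nhds_subtype _ _ _ |>.1 hV
      refine ⟨W, hW, fun x hx => extendZero_eq_zero_of_forall fun y hy => h y fun i => hWV ?_⟩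
      rw [Set.mem_preimage, hy]; exact hx i
    · exact ⟨Zᶜ, hZ.isOpen_compl.mem_nhds hpZ, fun x hx => extendZero_eq_zero_of_forall fun y hy =>
        absurd (hy 0 ▸ (y 0).2) (hx 0)⟩
  refine ⟨cls _ hφ, ?_⟩
  rw [restrict, quotMap_cls, cls_eq]
  intro p
  refine ⟨Set.univ, Filter.univ_mem, fun x _ => ?_⟩
  rw [Pi.sub_apply, pull_apply, sub_eq_zero]
  exact extendZero_apply ψ x fun _ => Set.mem_univ _

/-- Compactly supported cochains on `X` that restrict to zero on `Z`. -/
abbrev KerCochain {Z : Set X} (hZ : IsClosed Z) (n : ℕ) : Type u := LinearMap.ker (restrict hZ n)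

noncomputable instance {Z : Set X} (hZ : IsClosed Z) (n : ℕ) : AddCommGroup (KerCochain hZ n) :=
  Submodule.addCommGroup _

noncomputable instance {Z : Set X} (hZ : IsClosed Z) (n : ℕ) : Module ℚ (KerCochain hZ n) :=
  Submodule.module _

/-- The coboundary on the kernel of the restriction to `Z`. -/
noncomputable def kerDelta {Z : Set X} (hZ : IsClosed Z) (n : ℕ) :
    KerCochain hZ n →ₗ[ℚ] KerCochain hZ (n + 1) :=
  (compactD X n).restrict fun x hx => by
    rw [LinearMap.mem_ker] at *
    rw [restrict_compactD, hx, map_zero]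

theorem cls_mem_ker_restrict {Z : Set X} (hZ : IsClosed Z) {n : ℕ} {φ : Cochain X n}
    (hφ : φ ∈ compactlySupported X n) : cls φ hφ ∈ LinearMap.ker (restrict hZ n) ↔
      pull (Subtype.val : Z → X) n φ ∈ locallyZero Z n := by
  rw [LinearMap.mem_ker, restrict, quotMap_cls, cls_eq_zero]

/-- A cochain whose support does not meet `Z` restricts to zero on `Z`. -/
noncomputable def offToKer {Z : Set X} (hZ : IsClosed Z) (n : ℕ) :
    OffCochain Z n →ₗ[ℚ] KerCochain hZ n :=
  LinearMap.codRestrict _ (quotMap LinearMap.id (fun _ hφ => hφ.1) fun _ hφ => hφ) fun x => by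
      obtain ⟨φ, hφ, rfl⟩ := cls_surjective x
      exact (cls_mem_ker_restrict hZ hφ.1).2 fun z =>
        zeroNear_pull continuous_subtype_val.continuousAt (hφ.2 z z.2)

theorem offToKer_offDelta {Z : Set X} (hZ : IsClosed Z) (n : ℕ) (x : OffCochain Z n) :
    offToKer hZ (n + 1) (offDelta Z n x) = kerDelta hZ n (offToKer hZ n x) := by
  obtain ⟨φ, hφ, rfl⟩ := cls_surjective x
  rfl

end ClosedSubset

/-! #### Tautness of closed subsets -/

section Taut

variable {X : Type u} [TopologicalSpace X] {Z : Set X}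

/-- The function `f` moves the points of `X` so little, compared with the cochain `φ` vanishing on
`Z` and with support in the compact set `S`, and retracts so much onto `Z`, that the pullback of `φ`
along `f` and the prism operator for `id` and `f` can be controlled. -/
structure IsAdapted (Z : Set X) (f : X → X) (S : Set X) {n : ℕ} (φ : Cochain X n) : Prop where
  isCompact : IsCompact S
  eq_self : ∀ z ∈ Z, f z = z
  off : ∀ p ∉ S, ∃ W ∈ 𝓝 p, ∃ A, VanishesOn φ A ∧ (∀ y ∈ W, y ∈ A) ∧ ∀ y ∈ W, f y ∈ A
  near : ∀ z ∈ Z, ∃ W ∈ 𝓝 z, ∃ A, VanishesOn φ (A ∩ Z) ∧ (∀ y ∈ W, y ∈ A) ∧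
    (∀ y ∈ W, f y ∈ A) ∧ (z ∈ S → ∀ y ∈ W, f y ∈ Z)

theorem IsAdapted.pull_mem_supportedOff {f : X → X} {S : Set X} {n : ℕ} {φ : Cochain X n}
    (h : IsAdapted Z f S φ) : pull f n φ ∈ supportedOff Z n := by
  have hoff : ∀ p ∉ S, ZeroNear (pull f n φ) p := fun p hp => by
    obtain ⟨W, hW, A, hA, -, hf⟩ := h.off p hp
    exact ⟨W, hW, hA.pull hf⟩
  refine ⟨mem_compactlySupported_of_zeroNear h.isCompact hoff, fun z hz => ?_⟩
  by_cases hzS : z ∈ S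
  · obtain ⟨W, hW, A, hA, -, hf, hfZ⟩ := h.near z hz
    exact ⟨W, hW, hA.pull fun y hy => ⟨hf y hy, hfZ hzS y hy⟩⟩
  · exact hoff z hzS

theorem IsAdapted.prism_mem_compactlySupported {f : X → X} {S : Set X} {n : ℕ}
    {φ : Cochain X (n + 1)} (h : IsAdapted Z f S φ) :
    prism id f (n + 1) φ ∈ compactlySupported X n :=
  mem_compactlySupported_of_zeroNear h.isCompact fun p hp => zeroNear_prism (h.off p hp)

theorem IsAdapted.pull_prism_mem_locallyZero {f : X → X} {S : Set X} {n : ℕ}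
    {φ : Cochain X (n + 1)} (h : IsAdapted Z f S φ) :
    pull (Subtype.val : Z → X) n (prism id f (n + 1) φ) ∈ locallyZero Z n := by
  rintro ⟨z, hz⟩
  obtain ⟨W, hW, A, hA, hid, -⟩ := h.near z hz
  refine ⟨Subtype.val ⁻¹' W, continuous_subtype_val.continuousAt hW, fun x hx => ?_⟩
  rw [pull_apply]
  refine prism_eq_zero hA (fun i => ⟨hid _ (hx i), (x i).2⟩) fun i => ?_
  rw [Function.comp_apply, h.eq_self _ (x i).2]
  exact ⟨hid _ (hx i), (x i).2⟩

/-- A neighbourhood assignment such that every map which is a small retraction with respect to it, in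
the sense of `exists_small_retraction`, is adapted to `φ`. -/
theorem exists_nhds_isAdapted [LocallyCompactSpace X] [T2Space X] (hZ : IsClosed Z) {n : ℕ}
    {φ : Cochain X n} (hφ : φ ∈ compactlySupported X n)
    (hφZ : pull (Subtype.val : Z → X) n φ ∈ locallyZero Z n) :
    ∃ (S : Set X) (V : X → Set X), IsCompact S ∧ (∀ q, V q ∈ 𝓝 q) ∧
      ∀ f : X → X, (∀ z ∈ Z, f z = z) →
        (∀ p, ∃ W ∈ 𝓝 p, ∃ q, (∀ y ∈ W, y ∈ V q) ∧ (∀ y ∈ W, f y ∈ V q) ∧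
          (p ∈ Z → p ∈ S → ∀ y ∈ W, f y ∈ Z)) → IsAdapted Z f S φ := by
  obtain ⟨S, hS, hφS⟩ := exists_compact_superset hφ
  have h1 : ∀ q, ∃ V ∈ 𝓝 q, q ∉ support φ → VanishesOn φ V := fun q => by
    by_cases hq : q ∈ support φ
    · exact ⟨_, Filter.univ_mem, fun h => absurd hq h⟩
    · obtain ⟨V, hV, h⟩ := not_not.1 hq
      exact ⟨V, hV, fun _ => h⟩
  have h2 : ∀ q, ∃ V ∈ 𝓝 q, q ∈ support φ → V ⊆ S := fun q => by
    by_cases hq : q ∈ support φ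
    · exact ⟨S, mem_interior_iff_mem_nhds.1 (hφS hq), fun _ => le_rfl⟩
    · exact ⟨_, Filter.univ_mem, fun h => absurd h hq⟩
  have h3 : ∀ q, ∃ V ∈ 𝓝 q, VanishesOn φ (V ∩ Z) := fun q => by
    by_cases hq : q ∈ Z
    · obtain ⟨V, hV, h⟩ := hφZ ⟨q, hq⟩
      obtain ⟨W, hW, hWV⟩ := mem_nhds_subtype _ _ _ |>.1 hV
      refine ⟨W, hW, fun x hx => ?_⟩
      exact h (fun i => ⟨x i, (hx i).2⟩) fun i => hWV (hx i).1
    · exact ⟨Zᶜ, hZ.isOpen_compl.mem_nhds hq, fun x hx => absurd (hx 0).2 (hx 0).1⟩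
  choose V₁ hV₁ h1 using h1
  choose V₂ hV₂ h2 using h2
  choose V₃ hV₃ h3 using h3
  refine ⟨S, fun q => V₁ q ∩ V₂ q ∩ V₃ q, hS, fun q =>
    Filter.inter_mem (Filter.inter_mem (hV₁ q) (hV₂ q)) (hV₃ q), fun f hf h => ?_⟩
  refine ⟨hS, hf, fun p hp => ?_, fun z _ => ?_⟩
  · obtain ⟨W, hW, q, hid, hfW, -⟩ := h p
    have hq : q ∉ support φ := fun hq => hp (h2 q hq (hid p (mem_of_mem_nhds hW)).1.2)
    exact ⟨W, hW, V₁ q, h1 q hq, fun y hy => (hid y hy).1.1, fun y hy => (hfW y hy).1.1⟩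
  · obtain ⟨W, hW, q, hid, hfW, hfZ⟩ := h z
    exact ⟨W, hW, V₃ q, h3 q, fun y hy => (hid y hy).2, fun y hy => (hfW y hy).2, hfZ ‹_›⟩

theorem exists_nhds_vanishesOn {n : ℕ} {φ : Cochain X n} (hφ : φ ∈ locallyZero X n) :
    ∃ V : X → Set X, (∀ q, V q ∈ 𝓝 q) ∧ ∀ q, VanishesOn φ (V q) := by
  choose V hV h using hφ
  exact ⟨V, hV, h⟩

/-- Every class on `X` vanishing on `Z` is represented by a cocycle with support off `Z`. -/
theorem map_offToKer_surjective [LocallyCompactSpace X] [T2Space X] (hZ : IsClosed Z) (n : ℕ) :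
    Function.Surjective (SeqCohomology.map (A := OffCochain Z)
      (B := KerCochain hZ) (dA := offDelta Z) (dB := kerDelta hZ)
      (offToKer hZ) (offToKer_offDelta hZ) n) := by
  intro y
  obtain ⟨⟨y, hyZ⟩, hy, rfl⟩ := mk_surjective y
  obtain ⟨φ, hφ, rfl⟩ := cls_surjective y
  have hφZ := (cls_mem_ker_restrict hZ hφ).1 hyZ
  have hδ : delta X n φ ∈ locallyZero X (n + 1) := (cls_eq_zero _).1 (congrArg Subtype.val hy)
  obtain ⟨S, V, hS, hV, hVS⟩ := exists_nhds_isAdapted hZ hφ hφZ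
  obtain ⟨V', hV', hVδ⟩ := exists_nhds_vanishesOn hδ
  obtain ⟨f, hfZ, hf⟩ := exists_small_retraction Z hS fun q => Filter.inter_mem (hV q) (hV' q)
  have hA : IsAdapted Z f S φ := hVS f hfZ fun p => by
    obtain ⟨W, hW, q, h1, h2, h3⟩ := hf p
    exact ⟨W, hW, q, fun y hy => (h1 y hy).1, fun y hy => (h2 y hy).1, h3⟩
  have hf' : ∀ p, ∃ W ∈ 𝓝 p, ∃ A, VanishesOn (delta X n φ) A ∧ (∀ y ∈ W, id y ∈ A) ∧
      ∀ y ∈ W, f y ∈ A := fun p => by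
    obtain ⟨W, hW, q, h1, h2, -⟩ := hf p
    exact ⟨W, hW, V' q, hVδ q, fun y hy => (h1 y hy).2, fun y hy => (h2 y hy).2⟩
  have hpull : delta X n (pull f n φ) ∈ locallyZero X (n + 1) := fun p => by
    obtain ⟨W, hW, A, hA, -, h⟩ := hf' p
    exact ⟨W, hW, hA.pull h⟩
  refine ⟨mk (cls _ hA.pull_mem_supportedOff) ?_, ?_⟩
  · rw [offDelta_cls, cls_eq_zero]
    exact hpull
  rw [map_mk, mk_eq_mk]
  cases n with
  | zero =>
    refine (Submodule.mem_bot ℚ).2 (sub_eq_zero.2 (Subtype.ext ?_))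
    exact (cls_eq hA.pull_mem_supportedOff.1 hφ).2 (pull_sub_pull_mem_locallyZero hf')
  | succ n =>
    refine ⟨⟨cls _ hA.prism_mem_compactlySupported, (cls_mem_ker_restrict hZ _).2
      hA.pull_prism_mem_locallyZero⟩, Subtype.ext ?_⟩
    change cls _ _ = cls _ hA.pull_mem_supportedOff.1 - cls _ hφ
    refine ((cls_eq (sub_mem hA.pull_mem_supportedOff.1 hφ) _).2 ?_).symm
    exact pull_sub_pull_sub_delta_prism_mem_locallyZero hf'

/-- A cocycle supported off `Z` that bounds a cochain vanishing on `Z` bounds one supported off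
`Z`. -/
theorem map_offToKer_injective [LocallyCompactSpace X] [T2Space X] (hZ : IsClosed Z) (n : ℕ) :
    Function.Injective (SeqCohomology.map (A := OffCochain Z)
      (B := KerCochain hZ) (dA := offDelta Z) (dB := kerDelta hZ)
      (offToKer hZ) (offToKer_offDelta hZ) n) := by
  rw [injective_iff_map_eq_zero]
  intro x hx
  obtain ⟨y, hy, rfl⟩ := mk_surjective x
  obtain ⟨ψ, hψ, rfl⟩ := cls_surjective y
  rw [offDelta_cls, cls_eq_zero] at hy
  rw [map_mk, mk_eq_zero] at hx
  rw [mk_eq_zero]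
  cases n with
  | zero =>
    refine (cls_eq_zero hψ).2 ((cls_eq_zero hψ.1).1 ?_)
    exact congrArg Subtype.val ((Submodule.mem_bot ℚ).1 hx)
  | succ n =>
    obtain ⟨⟨y, hyZ⟩, hy'⟩ := hx
    obtain ⟨η, hη, rfl⟩ := cls_surjective y
    have hηZ := (cls_mem_ker_restrict hZ hη).1 hyZ
    have hlam : ψ - delta X n η ∈ locallyZero X (n + 1) :=
      (cls_eq hψ.1 (delta_mem_compactlySupported X n η hη)).1
        (congrArg Subtype.val hy').symm
    have hψZ : pull (Subtype.val : Z → X) (n + 1) ψ ∈ locallyZero Z (n + 1) := fun z =>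
      zeroNear_pull continuous_subtype_val.continuousAt (hψ.2 z z.2)
    obtain ⟨S, V, hS, hV, hVS⟩ := exists_nhds_isAdapted hZ hη hηZ
    obtain ⟨V₁, hV₁, hVδ⟩ := exists_nhds_vanishesOn hy
    obtain ⟨V₂, hV₂, hVlam⟩ := exists_nhds_vanishesOn hlam
    obtain ⟨S', V', hS', hV', hVS'⟩ := exists_nhds_isAdapted hZ hψ.1 hψZ
    have h3 : ∀ q, ∃ V ∈ 𝓝 q, (q ∈ Z → VanishesOn ψ V) ∧ (q ∉ Z → V ⊆ Zᶜ) := fun q => by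
      by_cases hq : q ∈ Z
      · obtain ⟨V, hV, h⟩ := hψ.2 q hq
        exact ⟨V, hV, fun _ => h, fun h => absurd hq h⟩
      · exact ⟨Zᶜ, hZ.isOpen_compl.mem_nhds hq, fun h => absurd h hq, fun _ => le_rfl⟩
    choose V₃ hV₃ h3 h3' using h3
    obtain ⟨f, hfZ, hf⟩ := exists_small_retraction Z (hS.union hS') (V := fun q =>
      V q ∩ V' q ∩ (V₁ q ∩ V₂ q ∩ V₃ q)) fun q => Filter.inter_mem
        (Filter.inter_mem (hV q) (hV' q)) (Filter.inter_mem (Filter.inter_mem (hV₁ q) (hV₂ q))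
          (hV₃ q))
    have hA : IsAdapted Z f S η := hVS f hfZ fun p => by
      obtain ⟨W, hW, q, h1, h2, h3⟩ := hf p
      exact ⟨W, hW, q, fun y hy => (h1 y hy).1.1, fun y hy => (h2 y hy).1.1,
        fun hp hpS => h3 hp (.inl hpS)⟩
    have hA' : IsAdapted Z f S' ψ := hVS' f hfZ fun p => by
      obtain ⟨W, hW, q, h1, h2, h3⟩ := hf p
      exact ⟨W, hW, q, fun y hy => (h1 y hy).1.2, fun y hy => (h2 y hy).1.2,
        fun hp hpS => h3 hp (.inr hpS)⟩
    have hf' : ∀ p, ∃ W ∈ 𝓝 p, ∃ A, VanishesOn (delta X (n + 1) ψ) A ∧ (∀ y ∈ W, id y ∈ A) ∧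
        ∀ y ∈ W, f y ∈ A := fun p => by
      obtain ⟨W, hW, q, h1, h2, -⟩ := hf p
      exact ⟨W, hW, V₁ q, hVδ q, fun y hy => (h1 y hy).2.1.1, fun y hy => (h2 y hy).2.1.1⟩
    have hpull : pull f (n + 1) (ψ - delta X n η) ∈ locallyZero X (n + 1) := fun p => by
      obtain ⟨W, hW, q, -, h2, -⟩ := hf p
      exact ⟨W, hW, (hVlam q).pull fun y hy => (h2 y hy).2.1.2⟩
    have hprism : prism id f (n + 1) ψ ∈ supportedOff Z n := by
      refine ⟨hA'.prism_mem_compactlySupported, fun z hz => zeroNear_prism ?_⟩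
      obtain ⟨W, hW, q, h1, h2, -⟩ := hf z
      have hq : q ∈ Z := by
        by_contra hq
        exact h3' q hq (h1 z (mem_of_mem_nhds hW)).2.2 hz
      exact ⟨W, hW, V₃ q, h3 q hq, fun y hy => (h1 y hy).2.2, fun y hy => (h2 y hy).2.2⟩
    -- `ψ ∼ f^* ψ - δ (prism ψ) ∼ δ (f^* η - prism ψ)`
    have hmem := sub_mem hA.pull_mem_supportedOff hprism
    refine ⟨cls _ hmem, ?_⟩
    rw [offDelta_cls, cls_eq]
    have hsum := sub_mem (pull_sub_pull_sub_delta_prism_mem_locallyZero hf') hpull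
    convert hsum using 1
    rw [map_sub, map_sub, delta_pull]
    have hid : pull id (n + 1) ψ = ψ := rfl
    rw [hid]
    abel

theorem offRestrict_offDelta (n : ℕ) (x : OffCochain Z n) :
    offRestrict Z (n + 1) (offDelta Z n x) = compactD (Zᶜ : Set X) n (offRestrict Z n x) := by
  obtain ⟨φ, hφ, rfl⟩ := cls_surjective x
  rfl

theorem offRestrict_bijective [LocallyCompactSpace X] [T2Space X] (hZ : IsClosed Z) (n : ℕ) :
    Function.Bijective (offRestrict Z n) :=
  ⟨offRestrict_injective hZ n, offRestrict_surjective hZ n⟩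

theorem map_offToKer_bijective [LocallyCompactSpace X] [T2Space X] (hZ : IsClosed Z) (n : ℕ) :
    Function.Bijective (SeqCohomology.map (A := OffCochain Z)
      (B := KerCochain hZ) (dA := offDelta Z) (dB := kerDelta hZ)
      (offToKer hZ) (offToKer_offDelta hZ) n) :=
  ⟨map_offToKer_injective hZ n, map_offToKer_surjective hZ n⟩

/-- Both the cochains vanishing on `Z` and the cochains supported off `Z` compute the compactly
supported cohomology of the complement. -/
theorem HasChi.hasEuler_ker [LocallyCompactSpace X] [T2Space X] (hZ : IsClosed Z) {b : ℤ}
    (hb : HasChi (Zᶜ : Set X) b) :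
    HasEuler (Cohomology (A := KerCochain hZ) (kerDelta hZ)) b := by
  have h : HasEuler (Cohomology (A := OffCochain Z) (offDelta Z)) b := by
    refine HasEuler.congr hb fun n => LinearEquiv.symm ?_
    exact cohomologyEquivOfBijective (A := OffCochain Z) (B := Compact (Zᶜ : Set X))
      (dA := offDelta Z) (dB := compactD (Zᶜ : Set X)) (offRestrict Z) offRestrict_offDelta
      (offRestrict_bijective hZ) n
  refine HasEuler.congr h fun n => ?_
  exact LinearEquiv.ofBijective _ (map_offToKer_bijective hZ n)

theorem hasChi_compl_of_hasEuler_ker [LocallyCompactSpace X] [T2Space X] (hZ : IsClosed Z) {b : ℤ}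
    (hb : HasEuler (Cohomology (A := KerCochain hZ) (kerDelta hZ)) b) :
    HasChi (Zᶜ : Set X) b := by
  have h : HasEuler (Cohomology (A := OffCochain Z) (offDelta Z)) b := by
    refine HasEuler.congr hb fun n => LinearEquiv.symm ?_
    exact LinearEquiv.ofBijective _ (map_offToKer_bijective hZ n)
  refine HasEuler.congr h fun n => ?_
  exact cohomologyEquivOfBijective (A := OffCochain Z) (B := Compact (Zᶜ : Set X))
    (dA := offDelta Z) (dB := compactD (Zᶜ : Set X)) (offRestrict Z) offRestrict_offDelta
    (offRestrict_bijective hZ) n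

/-- The inclusion of the cochains vanishing on `Z`. -/
noncomputable def kerInclusion (hZ : IsClosed Z) (n : ℕ) : KerCochain hZ n →ₗ[ℚ] Compact X n :=
  (LinearMap.ker (restrict hZ n)).subtype

theorem kerInclusion_kerDelta (hZ : IsClosed Z) (n : ℕ) (x : KerCochain hZ n) :
    kerInclusion hZ (n + 1) (kerDelta hZ n x) = compactD X n (kerInclusion hZ n x) := rfl

theorem exact_kerInclusion_restrict (hZ : IsClosed Z) (n : ℕ) :
    Function.Exact (kerInclusion hZ n) (restrict hZ n) :=
  fun x => ⟨fun hx => ⟨⟨x, hx⟩, rfl⟩, by rintro ⟨y, rfl⟩; exact y.2⟩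

/-- The long exact cohomology sequence of a closed subset, with the cohomology of the complement
computed by cochains vanishing on `Z`. -/
theorem exists_longExactSequence (hZ : IsClosed Z) :
    ∃ (f : ∀ n, Cohomology (A := KerCochain hZ) (kerDelta hZ) n →ₗ[ℚ] ConcreteCohomology X n)
      (g : ∀ n, ConcreteCohomology X n →ₗ[ℚ] ConcreteCohomology Z n)
      (δ : ∀ n, ConcreteCohomology Z n →ₗ[ℚ]
        Cohomology (A := KerCochain hZ) (kerDelta hZ) (n + 1)),
      (∀ n, Function.Exact (f n) (g n)) ∧ (∀ n, Function.Exact (g n) (δ n)) ∧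
      (∀ n, Function.Exact (δ n) (f (n + 1))) ∧ Function.Injective (f 0) := by
  obtain ⟨δ, h⟩ := exists_connecting (A := KerCochain hZ)
    (B := Compact X) (C := Compact Z) (dA := kerDelta hZ) (dB := compactD X)
    (dC := compactD Z) (fun _ => compactD_compactD)
    (kerInclusion hZ) (kerInclusion_kerDelta hZ) (restrict hZ)
    (restrict_compactD hZ) (fun n => Subtype.val_injective)
    (exact_kerInclusion_restrict hZ) (restrict_surjective hZ)
  exact ⟨_, _, δ, h⟩

/-- Additivity of the Euler characteristic with compact supports. -/
theorem HasChi.of_closed_of_compl [LocallyCompactSpace X] [T2Space X] (hZ : IsClosed Z) {a b : ℤ}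
    (ha : HasChi Z a) (hb : HasChi (Zᶜ : Set X) b) : HasChi X (a + b) := by
  obtain ⟨f, g, δ, h₁, h₂, h₃, h₀⟩ := exists_longExactSequence hZ
  rw [add_comm]
  exact HasEuler.middle h₁ h₂ h₃ h₀ (hb.hasEuler_ker hZ) ha

theorem HasChi.compl [LocallyCompactSpace X] [T2Space X] (hZ : IsClosed Z) {a b : ℤ}
    (ha : HasChi X a) (hb : HasChi Z b) : HasChi (Zᶜ : Set X) (a - b) := by
  obtain ⟨f, g, δ, h₁, h₂, h₃, h₀⟩ := exists_longExactSequence hZ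
  exact hasChi_compl_of_hasEuler_ker hZ (HasEuler.left h₁ h₂ h₃ h₀ ha hb)

end Taut

/-! ### Homotopy invariance and products -/

section Homotopy

variable {X : Type u} [TopologicalSpace X]

/-- A compactly supported cocycle is a coboundary if a homotopy from the identity that is constant
outside a compact set pushes the whole space off its support. -/
theorem mem_boundaries_of_homotopy [T2Space X] {n : ℕ} {φ : Cochain X n}
    (hδ : delta X n φ ∈ locallyZero X (n + 1)) {L : Set X} (hL : IsCompact L)
    (hφL : support φ ⊆ L) {G : unitInterval → X → X} (hG : Continuous fun p : unitInterval × X =>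
      G p.1 p.2) (h0 : ∀ x, G 0 x = x) (hGL : ∀ t, ∀ x ∉ L, G t x = x)
    (h1 : ∀ x, G 1 x ∉ support φ) : φ ∈ boundaries X n := by
  obtain ⟨V, hV, hVδ⟩ := exists_nhds_vanishesOn hδ
  let r : unitInterval → unitInterval → Prop := fun t t' =>
    pull (G t') n φ - pull (G t) n φ ∈ boundaries X n
  have hsymm : Std.Symm r := ⟨fun t t' h => by
    have := neg_mem h
    rwa [neg_sub] at this⟩
  have htrans : IsTrans unitInterval r := ⟨fun t t' t'' h h' => by
    have := add_mem h' h
    rwa [sub_add_sub_cancel] at this⟩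
  have hloc : ∀ t, ∀ᶠ t' in 𝓝 t, r t t' := fun t => by
    have key : ∀ᶠ t' in 𝓝 t, ∀ x ∈ L, ∃ W ∈ 𝓝 x, ∃ q, (∀ y ∈ W, G t y ∈ V q) ∧
        ∀ y ∈ W, G t' y ∈ V q := by
      refine hL.eventually_forall_of_forall_eventually fun x _ => ?_
      have hmem : (fun p : unitInterval × X => G p.1 p.2) ⁻¹' V (G t x) ∈ 𝓝 (t, x) :=
        hG.continuousAt (hV (G t x))
      rw [nhds_prod_eq, Filter.mem_prod_iff] at hmem
      obtain ⟨T, hT, W, hW, hTW⟩ := hmem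
      rw [nhds_prod_eq]
      filter_upwards [Filter.prod_mem_prod hT (eventually_mem_nhds_iff.2 hW)] with z hz
      exact ⟨W, hz.2, G t x, fun y hy => hTW (Set.mk_mem_prod (mem_of_mem_nhds hT) hy),
        fun y hy => hTW (Set.mk_mem_prod hz.1 hy)⟩
    filter_upwards [key] with t' ht'
    refine pull_sub_pull_mem_boundaries (fun p => ?_) hL fun p hp => ?_
    · by_cases hp : p ∈ L
      · obtain ⟨W, hW, q, h, h'⟩ := ht' p hp
        exact ⟨W, hW, V q, hVδ q, h, h'⟩
      · refine ⟨V p ∩ Lᶜ, Filter.inter_mem (hV p) (hL.isClosed.isOpen_compl.mem_nhds hp), V p,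
          hVδ p, fun y hy => ?_, fun y hy => ?_⟩
        · rw [hGL t y hy.2]; exact hy.1
        · rw [hGL t' y hy.2]; exact hy.1
    · obtain ⟨A, hA, hφA⟩ := not_not.1 fun h => hp (hφL h)
      refine ⟨A ∩ Lᶜ, Filter.inter_mem hA (hL.isClosed.isOpen_compl.mem_nhds hp), A,
          hφA, fun y hy => ?_, fun y hy => ?_⟩
      · rw [hGL t y hy.2]; exact hy.1
      · rw [hGL t' y hy.2]; exact hy.1
  have h01 : r 1 0 := PreconnectedSpace.induction₂ r hloc htrans 1 0
  have hG1 : pull (G 1) n φ ∈ boundaries X n := locallyZero_le_boundaries _ fun p =>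
    zeroNear_pull (hG.comp (Continuous.prodMk_right 1)).continuousAt (not_not.1 (h1 p))
  have hG0 : pull (G 0) n φ = φ := by
    rw [show G 0 = id from funext h0]; rfl
  have := add_mem h01 hG1
  rwa [sub_add_cancel, hG0] at this

/-- A product with a closed half-line has no cohomology with compact supports: pushing outwards along
the half-line, far enough over a compact set and not at all outside a larger one, moves the whole
space off the support of a given cocycle. -/
theorem hasChi_prod_nnreal (X : Type u) [TopologicalSpace X] [T2Space X] [LocallyCompactSpace X] :
    HasChi (X × NNReal) 0 := by
  refine hasEuler_zero fun n => subsingleton_cohomology fun φ hφ hδ => ?_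
  obtain ⟨B, hB⟩ := (hφ.image continuous_snd).bddAbove
  obtain ⟨w, hw1, -, hwc, hw⟩ := exists_continuous_one_zero_of_isCompact
    (hφ.image continuous_fst) isClosed_empty (Set.disjoint_empty _)
  let L : Set (X × NNReal) := tsupport w ×ˢ Set.Iic (B + 1)
  have hL : IsCompact L := by
    refine hwc.isCompact.prod ?_
    rw [← Set.Icc_bot]
    exact isCompact_Icc
  let G : unitInterval → X × NNReal → X × NNReal := fun t p =>
    (p.1, max p.2 (min (p.2 + Real.toNNReal (t * w p.1) * (B + 1)) (B + 1)))
  refine mem_boundaries_of_homotopy (G := G) hδ hL (fun p hp => ?_) ?_ (fun p => ?_)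
    (fun t p hp => ?_) fun p hp => ?_
  · refine ⟨subset_tsupport _ ?_, ?_⟩
    · rw [Function.mem_support, hw1 ⟨p, hp, rfl⟩]
      exact one_ne_zero
    · exact (hB ⟨p, hp, rfl⟩).trans (le_add_of_nonneg_right zero_le_one)
  · fun_prop
  · refine Prod.ext rfl ?_
    simp [G]
  · refine Prod.ext rfl ?_
    by_cases h : p.1 ∈ tsupport w
    · have h2 : B + 1 < p.2 := by
        by_contra h2
        exact hp ⟨h, not_lt.1 h2⟩
      exact max_eq_left ((min_le_right _ _).trans h2.le)
    · simp [G, image_eq_zero_of_notMem_tsupport h]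
  · have h1 : w p.1 = 1 := hw1 ⟨_, hp, rfl⟩
    have h2 : (G 1 p).2 ≤ B := hB ⟨_, hp, rfl⟩
    have h3 : B + 1 ≤ (G 1 p).2 := by
      simp [G, h1]
    exact absurd (h3.trans h2) (by simp)

/-- The open half-line, as the complement of the origin in the closed half-line, is a line. -/
noncomputable def prodHalfLineHomeomorph (X : Type u) [TopologicalSpace X] :
    ({p : X × NNReal | p.2 = 0}ᶜ : Set (X × NNReal)) ≃ₜ X × ℝ where
  toFun p := (p.1.1, Real.log p.1.2)
  invFun p := ⟨(p.1, ⟨Real.exp p.2, (Real.exp_pos _).le⟩), fun h =>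
    (Real.exp_pos p.2).ne' (congrArg NNReal.toReal h)⟩
  left_inv p := by
    have hp : (0 : ℝ) < p.1.2 := NNReal.coe_pos.2 (pos_iff_ne_zero.2 p.2)
    refine Subtype.ext (Prod.ext rfl (NNReal.coe_injective ?_))
    exact Real.exp_log hp
  right_inv p := Prod.ext rfl (Real.log_exp _)
  continuous_toFun := by
    refine Continuous.prodMk (by fun_prop) (Continuous.log (by fun_prop) fun p => ?_)
    exact NNReal.coe_ne_zero.2 p.2
  continuous_invFun := by
    refine Continuous.subtype_mk (Continuous.prodMk (by fun_prop) ?_) _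
    exact Continuous.subtype_mk (by fun_prop) _

/-- A slice of a product is a copy of the first factor. -/
def sliceHomeomorph (X : Type u) {Y : Type v} [TopologicalSpace X] [TopologicalSpace Y] (y : Y) :
    X ≃ₜ {p : X × Y | p.2 = y} where
  toFun x := ⟨(x, y), rfl⟩
  invFun p := p.1.1
  left_inv _ := rfl
  right_inv p := Subtype.ext (Prod.ext rfl p.2.symm)
  continuous_toFun := by fun_prop
  continuous_invFun := by fun_prop

variable [T2Space X] [LocallyCompactSpace X]

theorem HasChi.prod_real {c : ℤ} (h : HasChi X c) : HasChi (X × ℝ) (-c) := by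
  have hZ : IsClosed {p : X × NNReal | p.2 = 0} := isClosed_eq continuous_snd continuous_const
  have := ((hasChi_prod_nnreal X).compl hZ (h.congr (sliceHomeomorph X 0))).congr
    (prodHalfLineHomeomorph X)
  rwa [zero_sub] at this

theorem HasChi.prod_complex {c : ℤ} (h : HasChi X c) : HasChi (X × ℂ) c := by
  have h' := h.prod_real.prod_real
  rw [neg_neg] at h'
  exact h'.congr ((Homeomorph.prodAssoc X ℝ ℝ).trans
    ((Homeomorph.refl X).prodCongr Complex.equivRealProdCLM.symm.toHomeomorph))

/-- The punctured line has Euler characteristic zero. -/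
theorem HasChi.prod_complex_ne_zero {c : ℤ} (h : HasChi X c) :
    HasChi (X × {z : ℂ // z ≠ 0}) 0 := by
  have hZ : IsClosed {p : X × ℂ | p.2 = 0} := isClosed_eq continuous_snd continuous_const
  have h' := h.prod_complex.compl hZ (h.congr (sliceHomeomorph X 0))
  rw [sub_self] at h'
  refine h'.congr
    { toFun := fun p => (p.1.1, ⟨p.1.2, p.2⟩)
      invFun := fun p => ⟨(p.1, p.2), p.2.2⟩
      left_inv := fun _ => rfl
      right_inv := fun _ => rfl
      continuous_toFun := by fun_prop
      continuous_invFun := by fun_prop }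

theorem HasChi.prod_fin_complex {c : ℤ} (h : HasChi X c) (n : ℕ) :
    HasChi (X × (Fin n → ℂ)) c := by
  induction n with
  | zero => exact h.congr (Homeomorph.prodUnique X _).symm
  | succ n ih =>
    exact ih.prod_complex.congr ((Homeomorph.prodAssoc X _ ℂ).trans ((Homeomorph.refl X).prodCongr
      ((Homeomorph.prodComm _ _).trans
        (Fin.consEquivL ℂ fun _ : Fin (n + 1) => ℂ).toHomeomorph)))

theorem HasChi.prod_finiteDimensional {c : ℤ} (h : HasChi X c) (E : Type v) [NormedAddCommGroup E]
    [NormedSpace ℂ E] [FiniteDimensional ℂ E] : HasChi (X × E) c :=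
  (h.prod_fin_complex (Module.finrank ℂ E)).congr ((Homeomorph.refl X).prodCongr
    (ContinuousLinearEquiv.ofFinrankEq (Module.finrank_fin_fun ℂ)).toHomeomorph)

end Homotopy

/-! ### Filtrations by closed subsets -/

/-- The part of `A` lying in `B ⊆ A`, as a subset of the ambient space. -/
def subtypeSubsetHomeomorph {Y : Type u} [TopologicalSpace Y] {A B : Set Y} (C : Set A)
    (hC : ∀ y : A, y ∈ C ↔ (y : Y) ∈ B) (hBA : B ⊆ A) : C ≃ₜ B where
  toFun y := ⟨y.1.1, (hC y.1).1 y.2⟩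
  invFun y := ⟨⟨y.1, hBA y.2⟩, (hC ⟨y.1, hBA y.2⟩).2 y.2⟩
  left_inv _ := rfl
  right_inv _ := rfl
  continuous_toFun := by fun_prop
  continuous_invFun := by fun_prop

theorem HasChi.of_filtration {Y : Type u} [TopologicalSpace Y] [T2Space Y] [LocallyCompactSpace Y]
    {m : ℕ} {F : ℕ → Set Y} (hF : ∀ k, IsClosed (F k)) (hanti : ∀ k, F (k + 1) ⊆ F k)
    (hm : F m = ∅) {c : ℕ → ℤ} (hc : ∀ k < m, HasChi ↥(F k \ F (k + 1)) (c k)) :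
    HasChi (F 0) (∑ k ∈ Finset.range m, c k) := by
  induction m generalizing F c with
  | zero =>
    have : IsEmpty (F 0) := by rw [hm]; infer_instance
    exact hasChi_of_isEmpty _
  | succ m ih =>
    have h1 := ih (F := fun k => F (k + 1)) (fun k => hF _) (fun k => hanti _) hm
      (c := fun k => c (k + 1)) fun k hk => hc (k + 1) (by lia)
    have h0 := hc 0 (by lia)
    have : LocallyCompactSpace (F 0) := (hF 0).locallyCompactSpace
    rw [Finset.sum_range_succ']
    refine HasChi.of_closed_of_compl (Z := {y : F 0 | (y : Y) ∈ F 1})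
      ((hF 1).preimage continuous_subtype_val)
      (h1.congr (subtypeSubsetHomeomorph _ (fun _ => Iff.rfl) (hanti 0)).symm)
      (h0.congr (subtypeSubsetHomeomorph _ (fun y => ?_) Set.sdiff_subset).symm)
    exact ⟨fun h => ⟨y.2, h⟩, fun h => h.2⟩

end AlexanderSpanier

/-! ### Nondegenerate symmetric matrices -/

namespace SymmetricMatrix

open AlexanderSpanier Matrix

/-- The nondegenerate symmetric matrices of size `n`. -/
def nondeg (n : ℕ) : Set (Matrix (Fin n) (Fin n) ℂ) := {A | A.IsSymm ∧ A.det ≠ 0}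

/-- The nondegenerate symmetric matrices whose first row has its first nonzero entry, equal to `1`,
at position `i`. -/
def pivot (n : ℕ) (i : Fin (n + 1)) : Set (Matrix (Fin (n + 1)) (Fin (n + 1)) ℂ) :=
  {A | A ∈ nondeg (n + 1) ∧ (∀ j < i, A 0 j = 0) ∧ A 0 i = 1}

/-- The nondegenerate symmetric matrices whose first row is the `i`-th standard basis vector. -/
def unitRow (n : ℕ) (i : Fin (n + 1)) : Set (Matrix (Fin (n + 1)) (Fin (n + 1)) ℂ) :=
  {A | A ∈ nondeg (n + 1) ∧ A 0 = Pi.single i 1}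

instance (n : ℕ) : LocallyCompactSpace (Matrix (Fin n) (Fin n) ℂ) :=
  inferInstanceAs (LocallyCompactSpace (Fin n → Fin n → ℂ))

theorem isLocallyClosed_nondeg (n : ℕ) : IsLocallyClosed (nondeg n) :=
  (isClosed_eq (by fun_prop) continuous_id :
    IsClosed {A : Matrix (Fin n) (Fin n) ℂ | Aᵀ = A}).isLocallyClosed.inter
    ((isOpen_ne.preimage (by fun_prop : Continuous fun A : Matrix (Fin n) (Fin n) ℂ =>
      A.det)).isLocallyClosed)

instance (n : ℕ) : LocallyCompactSpace (nondeg n) :=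
  (isLocallyClosed_nondeg n).locallyCompactSpace

theorem continuous_entry {n : ℕ} (i j : Fin n) :
    Continuous fun A : Matrix (Fin n) (Fin n) ℂ => A i j := by fun_prop

instance (n : ℕ) (i : Fin (n + 1)) : LocallyCompactSpace (pivot n i) := by
  refine IsLocallyClosed.locallyCompactSpace ((isLocallyClosed_nondeg _).inter
    (IsClosed.isLocallyClosed (IsClosed.inter ?_ (isClosed_eq (continuous_entry _ _)
      continuous_const))))
  have : {A : Matrix (Fin (n + 1)) (Fin (n + 1)) ℂ | ∀ j < i, A 0 j = 0} =
      ⋂ j, ⋂ (_ : j < i), {A | A 0 j = 0} := by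
    ext A; simp
  change IsClosed {A : Matrix (Fin (n + 1)) (Fin (n + 1)) ℂ | ∀ j < i, A 0 j = 0}
  rw [this]
  exact isClosed_iInter fun j => isClosed_iInter fun _ =>
    isClosed_eq (continuous_entry _ _) continuous_const

instance (n : ℕ) (i : Fin (n + 1)) : LocallyCompactSpace (unitRow n i) :=
  IsLocallyClosed.locallyCompactSpace ((isLocallyClosed_nondeg _).inter
    (IsClosed.isLocallyClosed (isClosed_eq (by fun_prop) continuous_const)))

/-! #### Clearing the first row -/

/-- The elementary matrix subtracting multiples of the `i`-th basis vector, with coefficients given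
by `v`. -/
def elim {n : ℕ} (i : Fin n) (v : Fin n → ℂ) : Matrix (Fin n) (Fin n) ℂ :=
  1 - vecMulVec v (Pi.single i 1)

theorem elim_mulVec {n : ℕ} (i : Fin n) (v w : Fin n → ℂ) : elim i v *ᵥ w = w - w i • v := by
  funext k
  simp [elim, sub_mulVec, vecMulVec_mulVec, mul_comm]

theorem elim_mul_elim_neg {n : ℕ} {i : Fin n} {v : Fin n → ℂ} (hv : v i = 0) :
    elim i (-v) * elim i v = 1 := by
  have h : vecMulVec v (Pi.single i 1) * vecMulVec v (Pi.single i (1 : ℂ)) = 0 := by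
    rw [vecMulVec_mul_vecMulVec]
    simp [hv]
  simp only [elim, neg_vecMulVec, sub_neg_eq_add]
  rw [add_mul, mul_sub, mul_sub, h]
  simp

/-- The symmetric matrix obtained from `A` by the change of basis `elim i v`. -/
def act {n : ℕ} (i : Fin n) (v : Fin n → ℂ) (A : Matrix (Fin n) (Fin n) ℂ) :
    Matrix (Fin n) (Fin n) ℂ := elim i v * A * (elim i v)ᵀ

theorem act_neg_act {n : ℕ} {i : Fin n} {v : Fin n → ℂ} (hv : v i = 0)
    (A : Matrix (Fin n) (Fin n) ℂ) : act i (-v) (act i v A) = A := by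
  have h := elim_mul_elim_neg hv
  calc act i (-v) (act i v A) =
      (elim i (-v) * elim i v) * A * (elim i (-v) * elim i v)ᵀ := by
        simp only [act, transpose_mul, Matrix.mul_assoc]
    _ = A := by rw [h]; simp

theorem act_mem_nondeg {n : ℕ} {i : Fin n} {v : Fin n → ℂ} (hv : v i = 0)
    {A : Matrix (Fin n) (Fin n) ℂ} (hA : A ∈ nondeg n) : act i v A ∈ nondeg n := by
  have hdet : (elim i v).det ≠ 0 := fun h => by
    have := congrArg det (elim_mul_elim_neg hv)
    rw [det_mul, h, mul_zero, det_one] at this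
    exact zero_ne_one this
  refine ⟨?_, ?_⟩
  · rw [Matrix.IsSymm, act]
    simp only [transpose_mul, transpose_transpose, hA.1.eq, Matrix.mul_assoc]
  · rw [act, det_mul, det_mul, det_transpose]
    exact mul_ne_zero (mul_ne_zero hdet hA.2) hdet

theorem act_row_zero {n : ℕ} {i : Fin (n + 1)} {v : Fin (n + 1) → ℂ} (hv : v 0 = 0)
    (A : Matrix (Fin (n + 1)) (Fin (n + 1)) ℂ) : act i v A 0 = A 0 - A 0 i • v := by
  have h : (elim i v * A) 0 = A 0 := by
    funext k
    rw [elim, sub_mul, Matrix.sub_apply, one_mul, vecMulVec_mul, vecMulVec_apply, hv, zero_mul, sub_zero]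
  rw [act, ← elim_mulVec]
  funext k
  change (elim i v * A) 0 ⬝ᵥ (fun j => elim i v k j) = (fun j => elim i v k j) ⬝ᵥ A 0
  rw [h, dotProduct_comm]

theorem continuous_act {n : ℕ} (i : Fin n) {Y : Type*} [TopologicalSpace Y]
    {v : Y → Fin n → ℂ} {A : Y → Matrix (Fin n) (Fin n) ℂ} (hv : Continuous v)
    (hA : Continuous A) : Continuous fun y => act i (v y) (A y) := by
  have h : Continuous fun y => elim i (v y) := by
    refine continuous_const.sub ?_
    exact Continuous.matrix_vecMulVec hv continuous_const
  exact (h.matrix_mul hA).matrix_mul h.matrix_transpose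

/-- The vectors supported strictly after position `i`. -/
def tailSpace {n : ℕ} (i : Fin n) : Submodule ℂ (Fin n → ℂ) where
  carrier := {v | ∀ j ≤ i, v j = 0}
  zero_mem' _ _ := rfl
  add_mem' hv hw j hj := by rw [Pi.add_apply, hv j hj, hw j hj, add_zero]
  smul_mem' c v hv j hj := by rw [Pi.smul_apply, hv j hj, smul_zero]

/-- The difference between the first row of a matrix and the `i`-th basis vector. -/
def rowTail {n : ℕ} (i : Fin (n + 1)) (A : Matrix (Fin (n + 1)) (Fin (n + 1)) ℂ) :
    Fin (n + 1) → ℂ := A 0 - Pi.single i 1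

theorem rowTail_mem {n : ℕ} {i : Fin (n + 1)} {A : Matrix (Fin (n + 1)) (Fin (n + 1)) ℂ}
    (hA : A ∈ pivot n i) : rowTail i A ∈ tailSpace i := fun j hj => by
  rcases hj.lt_or_eq with hj | rfl
  · simp [rowTail, hA.2.1 j hj, hj.ne]
  · simp [rowTail, hA.2.2]

theorem continuous_rowTail {n : ℕ} (i : Fin (n + 1)) :
    Continuous fun A : pivot n i => rowTail i A.1 := by
  refine Continuous.sub (continuous_pi fun j => ?_) continuous_const
  exact (continuous_entry 0 j).comp continuous_subtype_val

/-- Clearing the first row after the pivot by a unipotent change of basis, which is determined by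
that row. -/
def pivotHomeomorph (n : ℕ) (i : Fin (n + 1)) : pivot n i ≃ₜ unitRow n i × tailSpace i where
  toFun A :=
    (⟨act i (rowTail i A.1) A.1, act_mem_nondeg (rowTail_mem A.2 i le_rfl) A.2.1, by
      rw [act_row_zero (rowTail_mem A.2 0 (Fin.zero_le i)), A.2.2.2, rowTail]
      simp⟩, ⟨rowTail i A.1, rowTail_mem A.2⟩)
  invFun p :=
    have hv : (-p.2.1) i = 0 := by rw [Pi.neg_apply, p.2.2 i le_rfl, neg_zero]
    have hrow : act i (-p.2.1) p.1.1 0 = Pi.single i 1 + p.2.1 := by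
      rw [act_row_zero (by rw [Pi.neg_apply, p.2.2 0 (Fin.zero_le i), neg_zero]), p.1.2.2]
      simp
    ⟨act i (-p.2.1) p.1.1, act_mem_nondeg hv p.1.2.1, fun j hj => by
      rw [hrow]
      simp [p.2.2 j hj.le, hj.ne], by
      rw [hrow]
      simp [p.2.2 i le_rfl]⟩
  left_inv A := Subtype.ext (act_neg_act (rowTail_mem A.2 i le_rfl) _)
  right_inv p := by
    have hrow : rowTail i (act i (-p.2.1) p.1.1) = p.2.1 := by
      rw [rowTail, act_row_zero (by rw [Pi.neg_apply, p.2.2 0 (Fin.zero_le i), neg_zero]), p.1.2.2]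
      simp
    refine Prod.ext (Subtype.ext ?_) (Subtype.ext hrow)
    change act i (rowTail i (act i (-p.2.1) p.1.1)) (act i (-p.2.1) p.1.1) = p.1.1
    rw [hrow]
    have h := act_neg_act (i := i) (v := -p.2.1)
      (by rw [Pi.neg_apply, p.2.2 i le_rfl, neg_zero]) p.1.1
    rwa [neg_neg] at h
  continuous_toFun :=
    ((continuous_act i (continuous_rowTail i) continuous_subtype_val).subtype_mk _).prodMk
      ((continuous_rowTail i).subtype_mk _)
  continuous_invFun :=
    (continuous_act i (by fun_prop) (by fun_prop)).subtype_mk _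

/-! #### Removing the first row -/

/-- The symmetric matrix with lower right block `D` and first row and column `(a, e)`. -/
def border {n : ℕ} (a : ℂ) (e : Fin n → ℂ) (D : Matrix (Fin n) (Fin n) ℂ) :
    Matrix (Fin (n + 1)) (Fin (n + 1)) ℂ :=
  Matrix.of (Fin.cons (Fin.cons a e) fun k => Fin.cons (e k) (D k))

theorem border_isSymm {n : ℕ} (a : ℂ) (e : Fin n → ℂ) {D : Matrix (Fin n) (Fin n) ℂ}
    (hD : D.IsSymm) : (border a e D).IsSymm := by
  refine IsSymm.ext fun i j => ?_
  cases i using Fin.cases <;> cases j using Fin.cases <;> try rfl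
  exact hD.apply _ _

theorem border_submatrix {n : ℕ} {a : ℂ} {e : Fin n → ℂ}
    {A : Matrix (Fin (n + 1)) (Fin (n + 1)) ℂ} (hA : A.IsSymm) (hrow : A 0 = Fin.cons a e) :
    border a e (A.submatrix Fin.succ Fin.succ) = A := by
  ext i j
  cases i using Fin.cases with
  | zero => exact (congrFun hrow j).symm
  | succ i =>
    cases j using Fin.cases with
    | zero =>
      rw [hA.apply, hrow]
      rfl
    | succ j => rfl

theorem continuous_border {n : ℕ} (a : ℂ) (e : Fin n → ℂ) : Continuous (border a e) := by
  refine continuous_matrix fun i j => ?_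
  cases i using Fin.cases with
  | zero => exact continuous_const
  | succ i =>
    cases j using Fin.cases with
    | zero => exact continuous_const
    | succ j => exact continuous_entry i j

/-- The matrix with `k`-th row and column `d`, and `C` as the minor obtained by deleting them. -/
def cross {n : ℕ} (k : Fin (n + 1)) (d : Fin (n + 1) → ℂ) (C : Matrix (Fin n) (Fin n) ℂ) :
    Matrix (Fin (n + 1)) (Fin (n + 1)) ℂ :=
  Matrix.of (k.insertNth d fun l => k.insertNth (d (k.succAbove l)) (C l))

theorem cross_self {n : ℕ} (k : Fin (n + 1)) (d : Fin (n + 1) → ℂ) (C : Matrix (Fin n) (Fin n) ℂ) :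
    cross k d C k = d := by
  change k.insertNth (α := fun _ => Fin (n + 1) → ℂ) d
    (fun l => k.insertNth (d (k.succAbove l)) (C l)) k = d
  simp

theorem cross_succAbove_self {n : ℕ} (k : Fin (n + 1)) (d : Fin (n + 1) → ℂ)
    (C : Matrix (Fin n) (Fin n) ℂ) (l : Fin n) :
    cross k d C (k.succAbove l) k = d (k.succAbove l) := by
  simp [cross]

theorem cross_succAbove_succAbove {n : ℕ} (k : Fin (n + 1)) (d : Fin (n + 1) → ℂ)
    (C : Matrix (Fin n) (Fin n) ℂ) (l m : Fin n) :
    cross k d C (k.succAbove l) (k.succAbove m) = C l m := by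
  simp [cross]

theorem cross_isSymm {n : ℕ} (k : Fin (n + 1)) (d : Fin (n + 1) → ℂ)
    {C : Matrix (Fin n) (Fin n) ℂ} (hC : C.IsSymm) : (cross k d C).IsSymm := by
  refine IsSymm.ext fun i j => ?_
  cases i using Fin.succAboveCases k with
  | x =>
    cases j using Fin.succAboveCases k with
    | x => rfl
    | p j => rw [cross_succAbove_self, cross_self]
  | p i =>
    cases j using Fin.succAboveCases k with
    | x => rw [cross_succAbove_self, cross_self]
    | p j => rw [cross_succAbove_succAbove, cross_succAbove_succAbove, hC.apply]

theorem cross_submatrix {n : ℕ} (k : Fin (n + 1)) {D : Matrix (Fin (n + 1)) (Fin (n + 1)) ℂ}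
    (hD : D.IsSymm) : cross k (D k) (D.submatrix k.succAbove k.succAbove) = D := by
  ext i j
  cases i using Fin.succAboveCases k with
  | x => rw [cross_self]
  | p i =>
    cases j using Fin.succAboveCases k with
    | x => rw [cross_succAbove_self, hD.apply]
    | p j => rw [cross_succAbove_succAbove, submatrix_apply]

theorem continuous_cross {n : ℕ} (k : Fin (n + 1)) : Continuous fun p :
    (Fin (n + 1) → ℂ) × Matrix (Fin n) (Fin n) ℂ => cross k p.1 p.2 := by
  refine continuous_matrix fun i j => ?_
  cases i using Fin.succAboveCases k with
  | x =>
    simp only [cross_self]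
    fun_prop
  | p i =>
    cases j using Fin.succAboveCases k with
    | x =>
      simp only [cross_succAbove_self]
      fun_prop
    | p j =>
      simp only [cross_succAbove_succAbove]
      fun_prop

theorem det_of_row_zero {n : ℕ} {A : Matrix (Fin (n + 1)) (Fin (n + 1)) ℂ} {i : Fin (n + 1)}
    (h : A 0 = Pi.single i 1) :
    A.det = (-1) ^ (i : ℕ) * (A.submatrix Fin.succ i.succAbove).det := by
  rw [det_succ_row_zero, Finset.sum_eq_single i]
  · simp [h]
  · intro j _ hj
    simp [h, hj]
  · exact fun h => absurd (Finset.mem_univ _) h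

theorem det_ne_zero_iff_zero {n : ℕ} {A : Matrix (Fin (n + 1)) (Fin (n + 1)) ℂ}
    (h : A 0 = Pi.single 0 1) : A.det ≠ 0 ↔ (A.submatrix Fin.succ Fin.succ).det ≠ 0 := by
  rw [det_of_row_zero h]
  simp

theorem det_ne_zero_iff_succ {n : ℕ} {A : Matrix (Fin (n + 2)) (Fin (n + 2)) ℂ}
    (hA : A.IsSymm) {k : Fin (n + 1)} (h : A 0 = Pi.single k.succ 1) :
    A.det ≠ 0 ↔
      ((A.submatrix Fin.succ Fin.succ).submatrix k.succAbove k.succAbove).det ≠ 0 := by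
  have h' : (A.submatrix Fin.succ k.succ.succAbove)ᵀ 0 = Pi.single k 1 := by
    funext l
    rw [transpose_apply, submatrix_apply, Fin.succ_succAbove_zero, hA.apply, h]
    simp [Pi.single_apply]
  have h'' : ((A.submatrix Fin.succ k.succ.succAbove)ᵀ.submatrix Fin.succ k.succAbove) =
      ((A.submatrix Fin.succ Fin.succ).submatrix k.succAbove k.succAbove)ᵀ := by
    ext l m
    simp [Fin.succ_succAbove_succ]
  rw [det_of_row_zero h, ← det_transpose (A.submatrix _ _), det_of_row_zero h', h'', det_transpose]
  simp

theorem cons_zero_eq_single {n : ℕ} :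
    (Fin.cons 1 0 : Fin (n + 1) → ℂ) = Pi.single 0 1 := by
  funext i
  cases i using Fin.cases <;> simp

theorem cons_single_eq_single {n : ℕ} (k : Fin n) :
    (Fin.cons 0 (Pi.single k 1) : Fin (n + 1) → ℂ) = Pi.single k.succ 1 := by
  funext i
  cases i using Fin.cases <;> simp [Pi.single_apply]

/-- A matrix with first row `e₀` is determined by its lower right block. -/
def unitRowZeroHomeomorph (n : ℕ) : unitRow n 0 ≃ₜ nondeg n where
  toFun A := ⟨A.1.submatrix Fin.succ Fin.succ, A.2.1.1.submatrix _,
    (det_ne_zero_iff_zero A.2.2).1 A.2.1.2⟩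
  invFun C := ⟨border 1 0 C.1, ⟨border_isSymm _ _ C.2.1,
    (det_ne_zero_iff_zero cons_zero_eq_single).2 C.2.2⟩, cons_zero_eq_single⟩
  left_inv A := Subtype.ext (border_submatrix A.2.1.1 (A.2.2.trans cons_zero_eq_single.symm))
  right_inv _ := rfl
  continuous_toFun := by fun_prop
  continuous_invFun := ((continuous_border _ _).comp continuous_subtype_val).subtype_mk _

/-- A matrix whose first row is a later basis vector `e` contains a hyperbolic plane: the row
paired with the first one is arbitrary, and what remains is nondegenerate. -/
def unitRowSuccHomeomorph (n : ℕ) (k : Fin (n + 1)) :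
    unitRow (n + 1) k.succ ≃ₜ nondeg n × (Fin (n + 1) → ℂ) where
  toFun A := (⟨(A.1.submatrix Fin.succ Fin.succ).submatrix k.succAbove k.succAbove,
    (A.2.1.1.submatrix _).submatrix _, (det_ne_zero_iff_succ A.2.1.1 A.2.2).1 A.2.1.2⟩,
    A.1.submatrix Fin.succ Fin.succ k)
  invFun p :=
    have hs := border_isSymm 0 (Pi.single k 1) (cross_isSymm k p.2 p.1.2.1)
    have hc : (cross k p.2 p.1.1).submatrix k.succAbove k.succAbove = p.1.1 := by
      ext l m
      exact cross_succAbove_succAbove k p.2 p.1.1 l m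
    ⟨border 0 (Pi.single k 1) (cross k p.2 p.1.1), ⟨hs,
      (det_ne_zero_iff_succ hs (cons_single_eq_single k)).2 (by
        change ((cross k p.2 p.1.1).submatrix k.succAbove k.succAbove).det ≠ 0
        rw [hc]
        exact p.1.2.2)⟩, cons_single_eq_single k⟩
  left_inv A := Subtype.ext (by
    change border 0 (Pi.single k 1) (cross k (A.1.submatrix Fin.succ Fin.succ k)
      ((A.1.submatrix Fin.succ Fin.succ).submatrix k.succAbove k.succAbove)) = A.1
    rw [cross_submatrix k (A.2.1.1.submatrix _)]
    exact border_submatrix A.2.1.1 (A.2.2.trans (cons_single_eq_single k).symm))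
  right_inv p := by
    refine Prod.ext (Subtype.ext ?_) ?_
    · ext l m
      exact cross_succAbove_succAbove k p.2 p.1.1 l m
    · exact cross_self k p.2 p.1.1
  continuous_toFun := by
    refine Continuous.prodMk (Continuous.subtype_mk (by fun_prop) _) (continuous_pi fun l => ?_)
    exact (continuous_entry k.succ l.succ).comp continuous_subtype_val
  continuous_invFun := by
    refine Continuous.subtype_mk ((continuous_border _ _).comp ?_) _
    exact (continuous_cross k).comp (by fun_prop :
      Continuous fun p : nondeg n × (Fin (n + 1) → ℂ) => (p.2, p.1.1))

/-! #### The Euler characteristic of the nondegenerate symmetric matrices -/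

/-- The Euler characteristic of `nondeg n`. -/
def nondegChi (n : ℕ) : ℤ := if n = 0 then 1 else 0

/-- The Euler characteristic of `pivot n k`. -/
def pivotChi (n k : ℕ) : ℤ := if k = 0 then nondegChi n else nondegChi (n - 1)

theorem hasChi_pivot_of_nondeg {n : ℕ} (hn : HasChi (nondeg n) (nondegChi n))
    (hn' : HasChi (nondeg (n - 1)) (nondegChi (n - 1))) (k : Fin (n + 1)) :
    HasChi (pivot n k) (pivotChi n k) := by
  have h : HasChi (unitRow n k) (pivotChi n k) := by
    cases k using Fin.cases with
    | zero => exact hn.congr (unitRowZeroHomeomorph n).symm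
    | succ k =>
      cases n with
      | zero => exact k.elim0
      | succ n => exact (hn'.prod_finiteDimensional _).congr (unitRowSuccHomeomorph n k).symm
  exact (h.prod_finiteDimensional _).congr (pivotHomeomorph n k).symm

/-- Dividing by the pivot entry. -/
noncomputable def scaleHomeomorph {n : ℕ} (k : Fin (n + 1)) :
    {A : nondeg (n + 1) | (∀ j < k, A.1 0 j = 0) ∧ A.1 0 k ≠ 0} ≃ₜ
      pivot n k × {z : ℂ // z ≠ 0} where
  toFun A := (⟨(A.1.1 0 k)⁻¹ • A.1.1, ⟨A.1.2.1.smul _, by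
      rw [det_smul]
      exact mul_ne_zero (pow_ne_zero _ (inv_ne_zero A.2.2)) A.1.2.2⟩,
      fun j hj => by simp [A.2.1 j hj], by simp [A.2.2]⟩, ⟨A.1.1 0 k, A.2.2⟩)
  invFun p := ⟨⟨p.2.1 • p.1.1, p.1.2.1.1.smul _, by
      rw [det_smul]
      exact mul_ne_zero (pow_ne_zero _ p.2.2) p.1.2.1.2⟩,
      fun j hj => by simp [p.1.2.2.1 j hj], by simp [p.1.2.2.2, p.2.2]⟩
  left_inv A := Subtype.ext (Subtype.ext (by simp [smul_smul, A.2.2]))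
  right_inv p := Prod.ext (Subtype.ext (by simp [smul_smul, p.1.2.2.2, p.2.2]))
    (Subtype.ext (by simp [p.1.2.2.2]))
  continuous_toFun := by
    have h : Continuous fun A : {A : nondeg (n + 1) | (∀ j < k, A.1 0 j = 0) ∧ A.1 0 k ≠ 0} =>
        A.1.1 0 k := (continuous_entry 0 k).comp (by fun_prop)
    exact Continuous.prodMk (Continuous.subtype_mk ((h.inv₀ fun A => A.2.2).smul
      (continuous_subtype_val.comp continuous_subtype_val)) _) (h.subtype_mk _)
  continuous_invFun := by fun_prop

/-- The nondegenerate symmetric matrices with the first `k` entries of the first row zero. -/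
def rowFiltration (n k : ℕ) : Set (nondeg (n + 1)) :=
  {A | ∀ j : Fin (n + 1), (j : ℕ) < k → A.1 0 j = 0}

theorem isClosed_rowFiltration (n k : ℕ) : IsClosed (rowFiltration n k) := by
  have : rowFiltration n k = ⋂ j : Fin (n + 1), ⋂ (_ : (j : ℕ) < k), {A | A.1 0 j = 0} := by
    ext A; simp [rowFiltration]
  rw [this]
  exact isClosed_iInter fun j => isClosed_iInter fun _ =>
    isClosed_eq ((continuous_entry _ _).comp continuous_subtype_val) continuous_const

theorem first_row_ne_zero {n : ℕ} {A : Matrix (Fin (n + 1)) (Fin (n + 1)) ℂ}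
    (hA : A ∈ nondeg (n + 1)) : ∃ j, A 0 j ≠ 0 := by
  by_contra! h
  exact hA.2 (det_eq_zero_of_row_eq_zero 0 h)

theorem hasChi_nondeg (n : ℕ) : HasChi (nondeg n) (nondegChi n) := by
  induction n using Nat.strong_induction_on with
  | _ n ih =>
  cases n with
  | zero =>
    have : Unique (nondeg 0) :=
      { default := ⟨0, Subsingleton.elim _ _, by simp⟩
        uniq := fun A => Subtype.ext (Subsingleton.elim _ _) }
    exact hasChi_of_unique
  | succ n =>
    have hp := hasChi_pivot_of_nondeg (ih n (by lia)) (ih (n - 1) (by lia))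
    have h := HasChi.of_filtration (m := n + 1) (F := rowFiltration n) (c := fun _ => 0)
      (isClosed_rowFiltration n) (fun k A hA j hj => hA j (by lia)) ?_ fun k hk => ?_
    · rw [Finset.sum_const_zero] at h
      refine h.congr ((Homeomorph.setCongr ?_).trans (Homeomorph.Set.univ _))
      exact Set.eq_univ_of_forall fun A j hj => absurd hj (by lia)
    · refine Set.eq_empty_of_forall_notMem fun A hA => ?_
      obtain ⟨j, hj⟩ := first_row_ne_zero A.2
      exact hj (hA j j.2)
    · refine (hp ⟨k, hk⟩).prod_complex_ne_zero.congr ((scaleHomeomorph ⟨k, hk⟩).symm.trans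
        (Homeomorph.setCongr ?_))
      ext A
      constructor
      · rintro ⟨h, h'⟩
        exact ⟨fun j hj => h j hj, fun h'' => h' (h'' ⟨k, hk⟩ (by simp))⟩
      · rintro ⟨h, h'⟩
        refine ⟨fun j hj => h j hj, fun h'' => h' fun j hj => ?_⟩
        rcases Nat.lt_succ_iff_lt_or_eq.1 hj with hj | hj
        · exact h j hj
        · rwa [show j = ⟨k, hk⟩ from Fin.ext hj]

theorem hasChi_pivot {n : ℕ} (k : Fin (n + 1)) : HasChi (pivot n k) (pivotChi n k) :=
  hasChi_pivot_of_nondeg (hasChi_nondeg _) (hasChi_nondeg _) k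

/-- Each stratum contributes the Euler characteristic of a smaller `nondeg`, which vanishes unless
the size is zero. -/
theorem sum_pivotChi (n : ℕ) :
    ∑ k ∈ Finset.range (n + 1), pivotChi n k = if n ≤ 1 then 1 else 0 := by
  rw [Finset.sum_range_succ']
  have h : ∀ k, pivotChi n (k + 1) = nondegChi (n - 1) := fun k => by simp [pivotChi]
  rw [Finset.sum_congr rfl fun k _ => h k, Finset.sum_const, Finset.card_range]
  rcases n with _ | _ | n <;> simp [pivotChi, nondegChi]

end SymmetricMatrix

/-! ### Charts of complex projective space -/

namespace ComplexProjective

variable {V : Type*} [AddCommGroup V] [Module ℂ V]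

theorem dual_rep_mk_ne_zero (f : Module.Dual ℂ V) {v : V} (hv : v ≠ 0) :
    f (Projectivization.mk ℂ v hv).rep ≠ 0 ↔ f v ≠ 0 := by
  obtain ⟨a, ha⟩ := Projectivization.exists_smul_eq_mk_rep ℂ v hv
  rw [← ha, Units.smul_def, map_smul]
  simp

/-- The representative of a point on which the linear form `f` takes the value `1` (or `0` if `f`
vanishes at the point). -/
noncomputable def unitRep (f : Module.Dual ℂ V) (p : ℙ ℂ V) : V := (f p.rep)⁻¹ • p.rep

theorem unitRep_mk (f : Module.Dual ℂ V) {v : V} (hv : v ≠ 0) :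
    unitRep f (Projectivization.mk ℂ v hv) = (f v)⁻¹ • v := by
  obtain ⟨a, ha⟩ := Projectivization.exists_smul_eq_mk_rep ℂ v hv
  rw [unitRep, ← ha, Units.smul_def, map_smul, smul_smul, smul_eq_mul, mul_inv, mul_right_comm,
    inv_mul_cancel₀ a.ne_zero, one_mul]

theorem apply_unitRep {f : Module.Dual ℂ V} {p : ℙ ℂ V} (hp : f p.rep ≠ 0) :
    f (unitRep f p) = 1 := by
  simp [unitRep, hp]

theorem mk_unitRep {f : Module.Dual ℂ V} {p : ℙ ℂ V}
    (h : unitRep f p ≠ 0) : Projectivization.mk ℂ (unitRep f p) h = p := by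
  conv_rhs => rw [← p.mk_rep]
  exact (Projectivization.mk_eq_mk_iff' _ _ _ _ _).2 ⟨_, rfl⟩

theorem ne_zero_of_apply_eq_one {f : Module.Dual ℂ V} {v : V} (h : f v = 1) : v ≠ 0 := by
  rintro rfl
  simp at h

theorem exists_dual_ne_zero {v w : V} (hv : v ≠ 0) (hw : w ≠ 0) :
    ∃ f : Module.Dual ℂ V, f v ≠ 0 ∧ f w ≠ 0 := by
  obtain ⟨f, hf⟩ : ∃ f : Module.Dual ℂ V, f v ≠ 0 := by
    by_contra! h
    exact hv ((Module.forall_dual_apply_eq_zero_iff ℂ v).1 h)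
  obtain ⟨g, hg⟩ : ∃ f : Module.Dual ℂ V, f w ≠ 0 := by
    by_contra! h
    exact hw ((Module.forall_dual_apply_eq_zero_iff ℂ w).1 h)
  by_cases hfw : f w = 0
  · by_cases hgv : g v = 0
    · exact ⟨f + g, by simpa [hgv] using hf, by simpa [hfw] using hg⟩
    · exact ⟨g, hgv, hg⟩
  · exact ⟨f, hf, hfw⟩

variable [TopologicalSpace V] [IsModuleTopology ℂ V]

variable (V) in
theorem isQuotientMap_mk' :
    Topology.IsQuotientMap (Projectivization.mk' ℂ : {v : V // v ≠ 0} → ℙ ℂ V) where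
  surjective p := ⟨⟨p.rep, p.rep_nonzero⟩, p.mk_rep⟩
  eq_coinduced := by
    rw [complexProjectiveTopology, ← eq_moduleTopology ℂ V]

theorem continuous_dual (f : Module.Dual ℂ V) : Continuous f :=
  have := IsModuleTopology.toContinuousAdd ℂ V
  IsModuleTopology.continuous_of_linearMap f

theorem isOpen_dual_ne_zero (f : Module.Dual ℂ V) : IsOpen {p : ℙ ℂ V | f p.rep ≠ 0} := by
  rw [← (isQuotientMap_mk' V).isOpen_preimage]
  have : Projectivization.mk' ℂ ⁻¹' {p : ℙ ℂ V | f p.rep ≠ 0} =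
      {v : {v : V // v ≠ 0} | f v ≠ 0} := by
    ext v
    exact dual_rep_mk_ne_zero f v.2
  rw [this]
  exact isOpen_ne.preimage ((continuous_dual f).comp continuous_subtype_val)

theorem continuousOn_unitRep (f : Module.Dual ℂ V) :
    ContinuousOn (unitRep f) {p : ℙ ℂ V | f p.rep ≠ 0} := by
  have := IsModuleTopology.toContinuousSMul ℂ V
  rw [(isQuotientMap_mk' V).continuousOn_isOpen_iff (isOpen_dual_ne_zero f)]
  have : unitRep f ∘ Projectivization.mk' ℂ = fun v : {v : V // v ≠ 0} => (f v)⁻¹ • (v : V) :=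
    funext fun v => unitRep_mk f v.2
  rw [this]
  refine ContinuousOn.smul (ContinuousOn.inv₀
    ((continuous_dual f).comp continuous_subtype_val).continuousOn fun v hv => ?_)
    continuous_subtype_val.continuousOn
  exact (dual_rep_mk_ne_zero f v.2).1 hv

/-- The affine chart where the linear form `f` does not vanish. -/
noncomputable def chart (f : Module.Dual ℂ V) :
    {p : ℙ ℂ V | f p.rep ≠ 0} ≃ₜ {v : V | f v = 1} where
  toFun p := ⟨unitRep f p.1, apply_unitRep p.2⟩
  invFun v := ⟨Projectivization.mk ℂ v.1 (ne_zero_of_apply_eq_one v.2),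
    (dual_rep_mk_ne_zero f _).2 (by rw [v.2.out]; exact one_ne_zero)⟩
  left_inv p := Subtype.ext (mk_unitRep _)
  right_inv v := Subtype.ext (by
    change unitRep f (Projectivization.mk ℂ v.1 _) = v.1
    rw [unitRep_mk, v.2.out, inv_one, one_smul])
  continuous_toFun :=
    (continuousOn_iff_continuous_domRestrict.1 (continuousOn_unitRep f)).subtype_mk _
  continuous_invFun := ((isQuotientMap_mk' V).continuous.comp
    (continuous_subtype_val.subtype_mk fun v => ne_zero_of_apply_eq_one v.2)).subtype_mk _

/-- Any two points lie in a common affine chart, so they can be separated. -/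
theorem t2Space [T2Space V] : T2Space (ℙ ℂ V) where
  t2 p q hpq := by
    obtain ⟨f, hp, hq⟩ := exists_dual_ne_zero p.rep_nonzero q.rep_nonzero
    have hU := isOpen_dual_ne_zero f
    have : T2Space {p : ℙ ℂ V | f p.rep ≠ 0} := (chart f).symm.t2Space
    obtain ⟨A, B, hA, hB, hpA, hqB, hAB⟩ := t2_separation
      (show (⟨p, hp⟩ : {p : ℙ ℂ V | f p.rep ≠ 0}) ≠ ⟨q, hq⟩ from
        fun h => hpq (congrArg Subtype.val h))
    exact ⟨_, _, hU.isOpenMap_subtype_val _ hA, hU.isOpenMap_subtype_val _ hB, ⟨_, hpA, rfl⟩,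
      ⟨_, hqB, rfl⟩, (Set.disjoint_image_iff Subtype.val_injective).2 hAB⟩

theorem locallyCompactSpace [T2Space V] [LocallyCompactSpace V] :
    LocallyCompactSpace (ℙ ℂ V) := by
  have := t2Space (V := V)
  have : WeaklyLocallyCompactSpace (ℙ ℂ V) := ⟨fun p => by
    obtain ⟨f, hp, -⟩ := exists_dual_ne_zero p.rep_nonzero p.rep_nonzero
    have hU := isOpen_dual_ne_zero f
    have : LocallyCompactSpace {v : V | f v = 1} :=
      (isClosed_eq (continuous_dual f) continuous_const).locallyCompactSpace
    have : LocallyCompactSpace {p : ℙ ℂ V | f p.rep ≠ 0} :=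
      (chart f).isClosedEmbedding.locallyCompactSpace
    obtain ⟨K, hK, hpK⟩ := exists_compact_mem_nhds (⟨p, hp⟩ : {p : ℙ ℂ V | f p.rep ≠ 0})
    exact ⟨_, hK.image continuous_subtype_val, hU.isOpenMap_subtype_val.image_mem_nhds hpK⟩⟩
  infer_instance

variable (V) in
/-- A finite-dimensional space with its module topology is homeomorphic to some `ℂ ^ d`. -/
theorem nonempty_homeomorph_pi [FiniteDimensional ℂ V] :
    Nonempty (V ≃ₜ (Fin (Module.finrank ℂ V) → ℂ)) := by
  have := IsModuleTopology.toContinuousAdd ℂ V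
  have e := (Module.finBasis ℂ V).equivFun
  exact ⟨{ toEquiv := e.toEquiv
           continuous_toFun := IsModuleTopology.continuous_of_linearMap e.toLinearMap
           continuous_invFun := IsModuleTopology.continuous_of_linearMap e.symm.toLinearMap }⟩

end ComplexProjective

/-! ### Quadrics and symmetric matrices -/

namespace ComplexQuadric

open AlexanderSpanier SymmetricMatrix ComplexProjective

section Basis

variable {M : Type*} [AddCommGroup M] [Module ℂ M] {n : ℕ} (b : Module.Basis (Fin n) ℂ M)

/-- The Gram matrix of a quadratic form in the basis `b`. -/
noncomputable def gram : QuadraticForm ℂ M →ₗ[ℂ] Matrix (Fin n) (Fin n) ℂ :=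
  (LinearMap.BilinForm.toMatrix b).toLinearMap ∘ₗ QuadraticMap.associated

/-- The quadratic form `x ↦ xᵀ A x` in the basis `b`. -/
noncomputable def ofMatrix : Matrix (Fin n) (Fin n) ℂ →ₗ[ℂ] QuadraticForm ℂ M :=
  LinearMap.BilinMap.toQuadraticMapLinearMap ℂ ℂ M ∘ₗ (Matrix.toBilin b).toLinearMap

/-- The `(i, j)` entry of the Gram matrix, as a linear form in the quadratic form. -/
noncomputable def entry (i j : Fin n) : Module.Dual ℂ (QuadraticForm ℂ M) :=
  Matrix.entryLinearMap ℂ ℂ i j ∘ₗ gram b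

theorem entry_apply (i j : Fin n) (Q : QuadraticForm ℂ M) : entry b i j Q = gram b Q i j := rfl

theorem gram_isSymm (Q : QuadraticForm ℂ M) : (gram b Q).IsSymm := by
  refine Matrix.IsSymm.ext fun i j => ?_
  simp only [gram, LinearMap.comp_apply, LinearEquiv.coe_coe, LinearMap.BilinForm.toMatrix_apply]
  exact QuadraticMap.associated_isSymm ℂ Q _ _

theorem ofMatrix_gram (Q : QuadraticForm ℂ M) : ofMatrix b (gram b Q) = Q := by
  simp only [ofMatrix, gram, LinearMap.comp_apply, LinearEquiv.coe_coe, Matrix.toBilin_toMatrix]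
  exact QuadraticMap.toQuadraticMap_associated ℂ Q

theorem gram_ofMatrix {A : Matrix (Fin n) (Fin n) ℂ} (hA : A.IsSymm) :
    gram b (ofMatrix b A) = A := by
  have h : QuadraticMap.associated (ofMatrix b A) = Matrix.toBilin b A := by
    refine QuadraticMap.associated_left_inverse ℂ fun x y => ?_
    simp only [LinearEquiv.coe_coe, Matrix.toBilin_apply]
    rw [Finset.sum_comm]
    refine Finset.sum_congr rfl fun i _ => Finset.sum_congr rfl fun j _ => ?_
    rw [hA.apply]
    ring
  rw [gram, LinearMap.comp_apply, h]
  exact LinearMap.BilinForm.toMatrix_toBilin b A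

theorem nondegenerate_iff (Q : QuadraticForm ℂ M) : Q.Nondegenerate ↔ gram b Q ∈ nondeg n := by
  rw [← QuadraticMap.nondegenerate_associated_iff]
  exact (LinearMap.BilinForm.nondegenerate_iff_det_ne_zero b).trans
    ⟨fun h => ⟨gram_isSymm b Q, h⟩, fun h => h.2⟩

theorem finiteDimensional (b : Module.Basis (Fin n) ℂ M) :
    FiniteDimensional ℂ (QuadraticForm ℂ M) :=
  Module.Finite.of_injective (gram b) (Function.LeftInverse.injective (ofMatrix_gram b))

/-- The discriminant, as a polynomial in the linear forms on the space of quadratic forms. -/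
noncomputable def discriminant : MvPolynomial (Module.Dual ℂ (QuadraticForm ℂ M)) ℂ :=
  (Matrix.of fun i j => MvPolynomial.X (entry b i j)).det

theorem isHomogeneous_discriminant : (discriminant b).IsHomogeneous n := by
  rw [discriminant, Matrix.det_apply]
  refine MvPolynomial.IsHomogeneous.sum _ _ _ fun σ _ => ?_
  have h := MvPolynomial.IsHomogeneous.prod Finset.univ
    (fun i : Fin n => (MvPolynomial.X (entry b (σ i) i) : MvPolynomial _ ℂ)) (fun _ => 1)
    fun i _ => MvPolynomial.isHomogeneous_X _ _
  rw [Finset.sum_const, Finset.card_univ, Fintype.card_fin, smul_eq_mul, mul_one] at h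
  rcases Int.units_eq_one_or (Equiv.Perm.sign σ) with hσ | hσ
  · rw [hσ, one_smul]
    exact h
  · rw [hσ, Units.neg_smul, one_smul]
    exact (MvPolynomial.homogeneousSubmodule _ ℂ n).neg_mem h

theorem eval_discriminant (Q : QuadraticForm ℂ M) :
    MvPolynomial.eval (fun f : Module.Dual ℂ (QuadraticForm ℂ M) => f Q) (discriminant b) =
      (gram b Q).det := by
  rw [discriminant, RingHom.map_det]
  congr 1
  ext i j
  simp [entry_apply]

theorem mem_nondegenerateQuadrics_iff {p : ℙ ℂ (QuadraticForm ℂ M)} :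
    p ∈ nondegenerateQuadrics M ↔ gram b p.rep ∈ nondeg n := nondegenerate_iff b _

theorem isZariskiOpen_nondegenerateQuadrics (b : Module.Basis (Fin n) ℂ M) :
    IsZariskiOpen (nondegenerateQuadrics M) := by
  refine ⟨{discriminant b}, ?_, ?_⟩
  · rintro P rfl
    exact ⟨n, isHomogeneous_discriminant b⟩
  · ext p
    simp [mem_nondegenerateQuadrics_iff b, nondeg, gram_isSymm, eval_discriminant]

theorem gram_rep_mk {Q : QuadraticForm ℂ M} (hQ : Q ≠ 0) :
    ∃ a : ℂ, a ≠ 0 ∧ gram b (Projectivization.mk ℂ Q hQ).rep = a • gram b Q := by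
  obtain ⟨a, ha⟩ := Projectivization.exists_smul_eq_mk_rep ℂ Q hQ
  exact ⟨a, a.ne_zero, by rw [← ha, Units.smul_def, map_smul]⟩

theorem smul_mem_nondeg_iff {a : ℂ} (ha : a ≠ 0) {A : Matrix (Fin n) (Fin n) ℂ} :
    a • A ∈ nondeg n ↔ A ∈ nondeg n := by
  have h : ∀ {a : ℂ}, a ≠ 0 → ∀ {A : Matrix (Fin n) (Fin n) ℂ}, A ∈ nondeg n → a • A ∈ nondeg n :=
    fun ha A hA => ⟨hA.1.smul _, by
      rw [Matrix.det_smul]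
      exact mul_ne_zero (pow_ne_zero _ ha) hA.2⟩
  refine ⟨fun hA => ?_, h ha⟩
  simpa [smul_smul, ha] using h (inv_ne_zero ha) hA

variable (M) in
theorem nondegenerateQuadrics_eq_empty [Subsingleton M] : nondegenerateQuadrics M = ∅ :=
  Set.eq_empty_of_forall_notMem fun p _ => p.rep_nonzero (QuadraticMap.ext fun x => by
    rw [Subsingleton.elim x 0]
    simp)

section Topology

variable [TopologicalSpace (QuadraticForm ℂ M)] [IsModuleTopology ℂ (QuadraticForm ℂ M)]

theorem continuous_gram : Continuous (gram b) :=
  IsModuleTopology.continuous_of_linearMap _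

theorem continuous_ofMatrix : Continuous (ofMatrix b) :=
  have := IsModuleTopology.topologicalAddGroup ℂ (QuadraticForm ℂ M)
  have := IsModuleTopology.toContinuousSMul ℂ (QuadraticForm ℂ M)
  LinearMap.continuous_of_finiteDimensional _

theorem isOpen_nondegenerateQuadrics (b : Module.Basis (Fin n) ℂ M) :
    IsOpen (nondegenerateQuadrics M) := by
  rw [← (isQuotientMap_mk' _).isOpen_preimage]
  have : Projectivization.mk' ℂ ⁻¹' nondegenerateQuadrics M =
      {Q : {Q : QuadraticForm ℂ M // Q ≠ 0} | (gram b Q).det ≠ 0} := by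
    ext Q
    obtain ⟨a, ha, h⟩ := gram_rep_mk b Q.2
    change Projectivization.mk ℂ Q.1 Q.2 ∈ nondegenerateQuadrics M ↔ _
    rw [mem_nondegenerateQuadrics_iff b, h, smul_mem_nondeg_iff ha]
    exact ⟨fun h => h.2, fun h => ⟨gram_isSymm b _, h⟩⟩
  rw [this]
  exact isOpen_ne.preimage (((continuous_gram b).comp continuous_subtype_val).matrix_det)

end Topology

end Basis

/-! ### Stratification of the nondegenerate quadrics -/

section Stratification

variable {M : Type*} [AddCommGroup M] [Module ℂ M] {n : ℕ} (b : Module.Basis (Fin (n + 1)) ℂ M)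

/-- The nondegenerate quadrics whose Gram matrix has its first nonzero entry in the first row at
position `k`. -/
def pivotQuadrics (k : Fin (n + 1)) : Set (ℙ ℂ (QuadraticForm ℂ M)) :=
  {p | gram b p.rep ∈ nondeg (n + 1) ∧ (∀ j < k, gram b p.rep 0 j = 0) ∧ gram b p.rep 0 k ≠ 0}

theorem ofMatrix_ne_zero {k : Fin (n + 1)} {A : Matrix (Fin (n + 1)) (Fin (n + 1)) ℂ}
    (hA : A ∈ pivot n k) : ofMatrix b A ≠ 0 := by
  intro h
  have h' := gram_ofMatrix b hA.1.1
  rw [h, map_zero] at h'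
  have := hA.2.2
  simp [← h'] at this

theorem gram_unitRep_mem_pivot {k : Fin (n + 1)} {p : ℙ ℂ (QuadraticForm ℂ M)}
    (hp : p ∈ pivotQuadrics b k) : gram b (unitRep (entry b 0 k) p) ∈ pivot n k := by
  have h := hp.2.2
  rw [unitRep, map_smul, entry_apply]
  exact ⟨(smul_mem_nondeg_iff (inv_ne_zero h)).2 hp.1, fun j hj => by simp [hp.2.1 j hj],
    by simp [h]⟩

theorem mk_ofMatrix_mem_pivotQuadrics {k : Fin (n + 1)}
    {A : Matrix (Fin (n + 1)) (Fin (n + 1)) ℂ} (hA : A ∈ pivot n k) :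
    Projectivization.mk ℂ (ofMatrix b A) (ofMatrix_ne_zero b hA) ∈ pivotQuadrics b k := by
  obtain ⟨a, ha, h⟩ := gram_rep_mk b (ofMatrix_ne_zero b hA)
  rw [gram_ofMatrix b hA.1.1] at h
  rw [pivotQuadrics, Set.mem_ofPred_eq, h]
  exact ⟨(smul_mem_nondeg_iff ha).2 hA.1, fun j hj => by simp [hA.2.1 j hj],
    by simp [hA.2.2, ha]⟩

variable [TopologicalSpace (QuadraticForm ℂ M)] [IsModuleTopology ℂ (QuadraticForm ℂ M)]

/-- Normalizing the Gram matrix so that its pivot is `1`. -/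
noncomputable def pivotQuadricsHomeomorph (k : Fin (n + 1)) : pivotQuadrics b k ≃ₜ pivot n k where
  toFun p := ⟨gram b (unitRep (entry b 0 k) p.1), gram_unitRep_mem_pivot b p.2⟩
  invFun A := ⟨Projectivization.mk ℂ (ofMatrix b A.1) (ofMatrix_ne_zero b A.2),
    mk_ofMatrix_mem_pivotQuadrics b A.2⟩
  left_inv p := Subtype.ext (by
    simp only [ofMatrix_gram]
    exact mk_unitRep _)
  right_inv A := Subtype.ext (by
    change gram b (unitRep _ (Projectivization.mk ℂ _ _)) = A.1
    rw [unitRep_mk, map_smul, entry_apply, gram_ofMatrix b A.2.1.1, A.2.2.2, inv_one, one_smul])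
  continuous_toFun := ((continuous_gram b).comp (continuousOn_iff_continuous_domRestrict.1
    ((continuousOn_unitRep (entry b 0 k)).mono fun p hp => hp.2.2))).subtype_mk _
  continuous_invFun := ((isQuotientMap_mk' _).continuous.comp
    (((continuous_ofMatrix b).comp continuous_subtype_val).subtype_mk
      fun A => ofMatrix_ne_zero b A.2)).subtype_mk _

/-- The nondegenerate quadrics whose Gram matrix has the first `k` entries of the first row zero. -/
def quadricFiltration (k : ℕ) : Set (nondegenerateQuadrics M) :=
  {p | ∀ j : Fin (n + 1), (j : ℕ) < k → gram b p.1.rep 0 j = 0}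

theorem isClosed_quadricFiltration (k : ℕ) : IsClosed (quadricFiltration b k) := by
  have : quadricFiltration b k = ⋂ j : Fin (n + 1), ⋂ (_ : (j : ℕ) < k),
      Subtype.val ⁻¹' {p | entry b 0 j p.rep ≠ 0}ᶜ := by
    ext p
    simp [quadricFiltration, entry_apply]
  rw [this]
  exact isClosed_iInter fun j => isClosed_iInter fun _ =>
    (isOpen_dual_ne_zero _).isClosed_compl.preimage continuous_subtype_val

theorem hasChi_nondegenerateQuadrics (b : Module.Basis (Fin (n + 1)) ℂ M) :
    HasChi (nondegenerateQuadrics M) (∑ k ∈ Finset.range (n + 1), pivotChi n k) := by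
  have := finiteDimensional b
  obtain ⟨e⟩ := nonempty_homeomorph_pi (QuadraticForm ℂ M)
  have : T2Space (QuadraticForm ℂ M) := e.symm.t2Space
  have : LocallyCompactSpace (QuadraticForm ℂ M) := e.isClosedEmbedding.locallyCompactSpace
  have := t2Space (V := QuadraticForm ℂ M)
  have := locallyCompactSpace (V := QuadraticForm ℂ M)
  have := (isOpen_nondegenerateQuadrics b).locallyCompactSpace
  have h := HasChi.of_filtration (m := n + 1) (F := quadricFiltration b) (c := pivotChi n)
    (isClosed_quadricFiltration b) (fun k p hp j hj => hp j (by lia)) ?_ fun k hk => ?_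
  · refine h.congr ((Homeomorph.setCongr ?_).trans (Homeomorph.Set.univ _))
    exact Set.eq_univ_of_forall fun p j hj => absurd hj (by lia)
  · refine Set.eq_empty_of_forall_notMem fun p hp => ?_
    obtain ⟨j, hj⟩ := first_row_ne_zero ((mem_nondegenerateQuadrics_iff b).1 p.2)
    exact hj (hp j j.2)
  · refine (hasChi_pivot ⟨k, hk⟩).congr ((pivotQuadricsHomeomorph b ⟨k, hk⟩).symm.trans
      (subtypeSubsetHomeomorph _ (fun p => ?_)
        fun p hp => (mem_nondegenerateQuadrics_iff b).2 hp.1).symm)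
    have hp := (mem_nondegenerateQuadrics_iff b).1 p.2
    constructor
    · rintro ⟨h, h'⟩
      refine ⟨hp, fun j hj => h j hj, fun h'' => h' fun j hj => ?_⟩
      rcases Nat.lt_succ_iff_lt_or_eq.1 hj with hj | hj
      · exact h j hj
      · rwa [show j = ⟨k, hk⟩ from Fin.ext hj]
    · rintro ⟨-, h, h'⟩
      exact ⟨fun j hj => h j hj, fun h'' => h' (h'' ⟨k, hk⟩ (by simp))⟩

end Stratification

end ComplexQuadric

theorem proposition4p1 {M : Type*} [AddCommGroup M] [Module ℂ M] [FiniteDimensional ℂ M]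
    (s : ℕ) (hs : Module.finrank ℂ M = s) :
    IsZariskiOpen (nondegenerateQuadrics M) ∧
    IsOpen (nondegenerateQuadrics M) ∧
    HasFiniteCompactCohomology (nondegenerateQuadrics M) ∧
    (s = 1 ∨ s = 2 → compactEulerChar (nondegenerateQuadrics M) = 1) ∧
    (3 ≤ s → compactEulerChar (nondegenerateQuadrics M) = 0) := by
  let _ : TopologicalSpace (QuadraticForm ℂ M) := moduleTopology ℂ _
  have : IsModuleTopology ℂ (QuadraticForm ℂ M) := ⟨rfl⟩
  have b := Module.finBasisOfFinrankEq ℂ M hs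
  refine ⟨ComplexQuadric.isZariskiOpen_nondegenerateQuadrics b,
    ComplexQuadric.isOpen_nondegenerateQuadrics b, ?_⟩
  cases s with
  | zero =>
    have : Subsingleton M := Module.finrank_zero_iff.1 hs
    have : IsEmpty (nondegenerateQuadrics M) :=
      Set.isEmpty_coe_sort.2 (ComplexQuadric.nondegenerateQuadrics_eq_empty M)
    exact ⟨(AlexanderSpanier.hasChi_of_isEmpty _).finite_and_eq.1, by lia, by lia⟩
  | succ n =>
    have h := (ComplexQuadric.hasChi_nondegenerateQuadrics b).finite_and_eq
    rw [SymmetricMatrix.sum_pivotChi] at h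
    refine ⟨h.1, fun hn => h.2.trans (if_pos (by lia)), fun hn => h.2.trans (if_neg (by lia))⟩
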